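/- Let $n\ge 0$ and let $S_n$ be the symmetric group, with $w\in S_n$ written in one-line notation $w_1w_2\cdots w_n$. Let $s_i=(i\;\,i+1)$, let $t_{ij}=(i\;\,j)$ (acting on positions when multiplied on the right), let $\ell(w)$ be the least number of simple transpositions $s_i$ in an expression of $w$ as a product, and let $w_0=n\,(n-1)\cdots 2\,1$. In the strong Bruhat order on $S_n$, $v\lessdot w$ is a covering relation when $w=vt_{ij}$ for some $i<j$ and $\ell(w)=\ell(v)+1$; for such a cover put $$b_{v\lessdot w}=\#\{k : i<k<j,\ v_k>v_j\},\qquad c_{v\lessdot w}=\#\{k : k>j,\ v_i<v_k<v_j\},$$ and define the weight $$\mathrm{wt}(v\lessdot w)=1+b_{v\lessdot w}(2-z)+c_{v\lessdot w}\,z\ \in\ \mathbb Z[z].$$ The weight of a saturated chain $u_1\lessdot u_2\lessdot\cdots\lessdot u_k$ is $\prod_{i=1}^{k-1}\mathrm{wt}(u_i\lessdot u_{i+1})$, and $m_{\mathrm{wt}}(v,w)$ denotes the sum of the weights of all saturated chains from $v$ to $w$. Let $\mathfrak S_w(x_1,\dots,x_n)$ be the Schubert polynomials, defined by $\mathfrak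 S_{w_0}=x_1^{n-1}x_2^{n-2}\cdots x_{n-1}$ and $\mathfrak S_{ws_i}=N_i\mathfrak S_w$ whenever $\ell(ws_i)<\ell(w)$, where $$N_i g=\frac{g(x_1,\dots,x_n)-g(x_1,\dots,x_{i+1},x_i,\dots,x_n)}{x_i-x_{i+1}}.$$ **Theorem.** For every $w\in S_n$, the following identity holds in $\mathbb Z[z]$: $$m_{\mathrm{wt}}(w,w_0)=\left(\binom n2-\ell(w)\right)!\cdot\mathfrak S_w(1,\dots,1).$$ In particular, $m_{\mathrm{wt}}(w,w_0)$ does not depend on $z$. -/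

import Mathlib

namespace BruhatChains

/-! ### The symmetric group and its strong Bruhat order

The symmetric group `S_n` is `Equiv.Perm (Fin n)`.  Positions and values are indexed from `0`,
the one-line notation of `w` is `w 0, w 1, …, w (n - 1)`, and `v * Equiv.swap i j` is `v` with
the entries in positions `i` and `j` exchanged. -/

/-- The adjacent transposition exchanging the positions `i` and `i + 1`. -/
def adjSwap {n : ℕ} (i : Fin (n - 1)) : Equiv.Perm (Fin n) :=
  Equiv.swap ⟨i, by omega⟩ ⟨i + 1, by omega⟩

/-- The length `ℓ(w)`: the least number of factors in an expression of `w` as a product of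
adjacent transpositions. -/
noncomputable def length {n : ℕ} (w : Equiv.Perm (Fin n)) : ℕ :=
  sInf {k | ∃ a : List (Fin (n - 1)), a.length = k ∧ (a.map adjSwap).prod = w}

/-- The covering relation `v ⋖ w` of the strong Bruhat order: `w = v t_{ij}` for a transposition
`t_{ij}`, and `ℓ(w) = ℓ(v) + 1`. -/
def Covers {n : ℕ} (v w : Equiv.Perm (Fin n)) : Prop :=
  (∃ i j : Fin n, i < j ∧ w = v * Equiv.swap i j) ∧ length w = length v + 1

/-- The longest element `w₀ = n (n-1) ⋯ 2 1`. -/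
def longest (n : ℕ) : Equiv.Perm (Fin n) := Fin.revPerm

/-- `b_{v ⋖ w}` is the number of `k` with `i < k < j` and `v_k > v_j`, where `i < j` is the
(unique) pair of positions with `w = v t_{ij}`. -/
def bNum {n : ℕ} (v w : Equiv.Perm (Fin n)) : ℕ :=
  (Finset.univ.filter fun k : Fin n =>
    ∃ i j : Fin n, i < j ∧ w = v * Equiv.swap i j ∧ i < k ∧ k < j ∧ v j < v k).card

/-- `c_{v ⋖ w}` is the number of `k > j` with `v_i < v_k < v_j`, where `i < j` is the
(unique) pair of positions with `w = v t_{ij}`. -/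
def cNum {n : ℕ} (v w : Equiv.Perm (Fin n)) : ℕ :=
  (Finset.univ.filter fun k : Fin n =>
    ∃ i j : Fin n, i < j ∧ w = v * Equiv.swap i j ∧ j < k ∧ v i < v k ∧ v k < v j).card

/-! ### Weighted enumeration of saturated chains -/

/-- The saturated chains `v = u₁ ⋖ u₂ ⋖ ⋯ ⋖ u_k = w`, as lists `[u₁, …, u_k]`. -/
def saturatedChains {n : ℕ} (v w : Equiv.Perm (Fin n)) : Set (List (Equiv.Perm (Fin n))) :=
  {c | c.IsChain Covers ∧ c.head? = some v ∧ c.getLast? = some w}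

theorem saturatedChains_finite {n : ℕ} (v w : Equiv.Perm (Fin n)) :
    (saturatedChains v w).Finite := by
  have h : {l : List (Equiv.Perm (Fin n)) | l.Nodup}.Finite :=
    Set.finite_coe_iff.1 (Finite.of_fintype {l : List (Equiv.Perm (Fin n)) // l.Nodup})
  refine h.subset fun c hc => ?_
  have h1 : (c.map length).IsChain (· < ·) := by
    rw [List.isChain_map]
    exact hc.1.imp fun a b hab => by have := hab.2; omega
  have h2 : (c.map length).Nodup := (List.isChain_iff_pairwise.1 h1).imp fun h => ne_of_lt h
  exact h2.of_map _

/-- The weight of a chain `u₁ ⋖ ⋯ ⋖ u_k` is the product of the weights of `u_i ⋖ u_{i+1}`. -/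
def chainWeight {n : ℕ} {R : Type*} [CommRing R]
    (wt : Equiv.Perm (Fin n) → Equiv.Perm (Fin n) → R) (c : List (Equiv.Perm (Fin n))) : R :=
  (List.zipWith wt c c.tail).prod

/-- `m_wt(v, w)`, the sum of the weights of all saturated chains from `v` to `w`. -/
noncomputable def weightedChainCount {n : ℕ} {R : Type*} [CommRing R]
    (wt : Equiv.Perm (Fin n) → Equiv.Perm (Fin n) → R) (v w : Equiv.Perm (Fin n)) : R :=
  ∑ c ∈ (saturatedChains_finite v w).toFinset, chainWeight wt c

/-- The weight `1 + b_{v ⋖ w} (2 - z) + c_{v ⋖ w} z` in `ℤ[z]` of a cover `v ⋖ w`. -/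
noncomputable def macdonaldWeight {n : ℕ} (v w : Equiv.Perm (Fin n)) : Polynomial ℤ :=
  1 + (bNum v w : Polynomial ℤ) * (2 - Polynomial.X) + (cNum v w : Polynomial ℤ) * Polynomial.X

/-! ### Schubert polynomials -/

/-- Exchange of the variables `x_i` and `x_{i+1}`. -/
noncomputable def swapVars {n : ℕ} (i : Fin (n - 1)) (g : MvPolynomial (Fin n) ℤ) :
    MvPolynomial (Fin n) ℤ :=
  MvPolynomial.rename (adjSwap i) g

theorem exists_dividedDifference {n : ℕ} (i : Fin (n - 1)) (g : MvPolynomial (Fin n) ℤ) :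
    ∃ q : MvPolynomial (Fin n) ℤ,
      g - swapVars i g =
        (MvPolynomial.X ⟨i, by omega⟩ - MvPolynomial.X ⟨i + 1, by omega⟩) * q := by
  set d : MvPolynomial (Fin n) ℤ :=
    MvPolynomial.X ⟨i, by omega⟩ - MvPolynomial.X ⟨i + 1, by omega⟩ with hd
  change d ∣ _
  have key : (Ideal.Quotient.mkₐ ℤ (Ideal.span {d})).comp (MvPolynomial.rename (adjSwap i)) =
      Ideal.Quotient.mkₐ ℤ (Ideal.span {d}) := by
    refine MvPolynomial.algHom_ext fun k => ?_
    simp only [AlgHom.comp_apply, MvPolynomial.rename_X, Ideal.Quotient.mkₐ_eq_mk]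
    rw [Ideal.Quotient.mk_eq_mk_iff_sub_mem, Ideal.mem_span_singleton]
    unfold adjSwap
    rw [Equiv.swap_apply_def]
    split_ifs with h1 h2
    · subst h1
      exact ⟨-1, by rw [hd]; ring⟩
    · subst h2
      exact ⟨1, by rw [hd]; ring⟩
    · simp
  have h := DFunLike.congr_fun key g
  simp only [AlgHom.comp_apply, Ideal.Quotient.mkₐ_eq_mk] at h
  rw [← Ideal.mem_span_singleton, ← Ideal.Quotient.mk_eq_mk_iff_sub_mem]
  exact h.symm

/-- The Newton divided difference operator
`N_i g = (g - g(…, x_{i+1}, x_i, …)) / (x_i - x_{i+1})`; the quotient is again a polynomial. -/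
noncomputable def dividedDifference {n : ℕ} (i : Fin (n - 1)) (g : MvPolynomial (Fin n) ℤ) :
    MvPolynomial (Fin n) ℤ :=
  (exists_dividedDifference i g).choose

theorem dividedDifference_spec {n : ℕ} (i : Fin (n - 1)) (g : MvPolynomial (Fin n) ℤ) :
    g - swapVars i g =
      (MvPolynomial.X ⟨i, by omega⟩ - MvPolynomial.X ⟨i + 1, by omega⟩) *
        dividedDifference i g :=
  (exists_dividedDifference i g).choose_spec

open Classical in
/-- The Schubert polynomial `𝔖_w`, defined by downward recursion on the length: it is
`N_i 𝔖_{w s_i}` if `ℓ(w s_i) > ℓ(w)` for some `i`, and it is `x^ρ` with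
`ρ = (n-1, n-2, …, 1, 0)` if there is no such `i`, i.e. for `w = w₀`.  The definition picks one
such `i`; by `schubert_longest` and `schubert_mul_adjSwap` below the family has the usual
defining properties `𝔖_{w₀} = x^ρ` and `𝔖_{w s_i} = N_i 𝔖_w` for all `w` and all `i` with
`ℓ(w s_i) < ℓ(w)`, so that the choice does not matter. -/
noncomputable def schubert {n : ℕ} (w : Equiv.Perm (Fin n)) : MvPolynomial (Fin n) ℤ :=
  if h : ∃ i : Fin (n - 1), length w < length (w * adjSwap i) then
    dividedDifference h.choose (schubert (w * adjSwap h.choose))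
  else ∏ i : Fin n, MvPolynomial.X i ^ (n - 1 - (i : ℕ))
termination_by Finset.univ.sup (length (n := n)) - length w
decreasing_by
  have := h.choose_spec
  have := Finset.le_sup (f := length (n := n)) (Finset.mem_univ (w * adjSwap h.choose))
  omega

/-! ### Length and descents, and the recursion for Schubert polynomials -/

/-- The number of inversions of `w`. -/
def invCount {n : ℕ} (w : Equiv.Perm (Fin n)) : ℕ :=
  (Finset.univ.filter fun p : Fin n × Fin n => p.1 < p.2 ∧ w p.2 < w p.1).card

theorem inv_adjSwap_aux {n : ℕ} (w : Equiv.Perm (Fin n)) {a b : Fin n}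
    (hab : (a : ℕ) + 1 = b) (h : w a < w b) (p q : Fin n) :
    (p < q ∧ w (Equiv.swap a b q) < w (Equiv.swap a b p)) ↔
      ((p = a ∧ q = b) ∨ (Equiv.swap a b p < Equiv.swap a b q ∧
        w (Equiv.swap a b q) < w (Equiv.swap a b p))) := by
  have hne : a ≠ b := fun h1 => by rw [h1] at hab; omega
  rcases eq_or_ne p a with rfl | pa
  · rcases eq_or_ne q b with rfl | qb
    · refine iff_of_true ⟨?_, ?_⟩ (Or.inl ⟨rfl, rfl⟩)
      · rw [Fin.lt_def]
        omega
      · rwa [Equiv.swap_apply_left, Equiv.swap_apply_right]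
    · rcases eq_or_ne q p with rfl | qa
      · simp [qb]
      · rw [Equiv.swap_apply_left, Equiv.swap_apply_of_ne_of_ne qa qb]
        have : p < q ↔ b < q := by
          rw [Fin.lt_def, Fin.lt_def]
          rw [ne_eq, Fin.ext_iff] at qa qb
          omega
        simp [this, qb]
  · rcases eq_or_ne p b with rfl | pb
    · rcases eq_or_ne q a with rfl | qa
      · rw [Equiv.swap_apply_left, Equiv.swap_apply_right]
        simp [h.not_gt, pa]
      · rcases eq_or_ne q p with rfl | qb
        · simp [pa]
        · rw [Equiv.swap_apply_right, Equiv.swap_apply_of_ne_of_ne qa qb]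
          have : p < q ↔ a < q := by
            rw [Fin.lt_def, Fin.lt_def]
            rw [ne_eq, Fin.ext_iff] at qa qb
            omega
          simp [this, pa]
    · rw [Equiv.swap_apply_of_ne_of_ne pa pb]
      rw [ne_eq, Fin.ext_iff] at pa pb
      rcases eq_or_ne q a with rfl | qa
      · rw [Equiv.swap_apply_left]
        have : p < q ↔ p < b := by
          rw [Fin.lt_def, Fin.lt_def]
          omega
        simp [this, hne]
      · rcases eq_or_ne q b with rfl | qb
        · rw [Equiv.swap_apply_right]
          have : p < q ↔ p < a := by
            rw [Fin.lt_def, Fin.lt_def]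
            omega
          simp [this, Fin.ext_iff, pa]
        · rw [Equiv.swap_apply_of_ne_of_ne qa qb]
          simp [qb]

theorem invCount_one (n : ℕ) : invCount (1 : Equiv.Perm (Fin n)) = 0 := by
  unfold invCount
  rw [Finset.card_eq_zero, Finset.filter_eq_empty_iff]
  rintro p - ⟨h1, h2⟩
  exact lt_asymm h1 h2

theorem invCount_mul_adjSwap {n : ℕ} (w : Equiv.Perm (Fin n)) (i : Fin (n - 1))
    (h : w ⟨i, by omega⟩ < w ⟨i + 1, by omega⟩) :
    invCount (w * adjSwap i) = invCount w + 1 := by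
  have hs : (Finset.univ.filter fun p : Fin n × Fin n =>
        p.1 < p.2 ∧ (w * adjSwap i) p.2 < (w * adjSwap i) p.1) =
      insert (⟨i, by omega⟩, ⟨i + 1, by omega⟩)
        ((Finset.univ.filter fun p : Fin n × Fin n => p.1 < p.2 ∧ w p.2 < w p.1).map
          ((adjSwap i).prodCongr (adjSwap i)).toEmbedding) := by
    ext ⟨p, q⟩
    rw [Finset.mem_insert, Finset.mem_map_equiv, Finset.mem_filter, Finset.mem_filter]
    simp only [Finset.mem_univ, true_and, Equiv.Perm.mul_apply,
      Equiv.prodCongr_symm, Equiv.prodCongr_apply, Prod.map, Prod.mk.injEq]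
    have hsym : (adjSwap i).symm = adjSwap i := Equiv.symm_swap _ _
    rw [hsym]
    exact inv_adjSwap_aux w rfl h p q
  unfold invCount
  rw [hs, Finset.card_insert_of_notMem, Finset.card_map]
  rw [Finset.mem_map_equiv]
  have hsym : (adjSwap i).symm = adjSwap i := Equiv.symm_swap _ _
  simp only [Finset.mem_filter, Finset.mem_univ, true_and, Equiv.prodCongr_symm,
    Equiv.prodCongr_apply, Prod.map, hsym]
  unfold adjSwap
  rw [Equiv.swap_apply_left, Equiv.swap_apply_right]
  rintro ⟨h1, -⟩
  have h2 : (i : ℕ) + 1 < i := h1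
  omega

theorem mul_adjSwap_mul_adjSwap {n : ℕ} (w : Equiv.Perm (Fin n)) (i : Fin (n - 1)) :
    w * adjSwap i * adjSwap i = w := by
  rw [mul_assoc, adjSwap, Equiv.swap_mul_self, mul_one]

theorem invCount_mul_adjSwap' {n : ℕ} (w : Equiv.Perm (Fin n)) (i : Fin (n - 1))
    (h : w ⟨i + 1, by omega⟩ < w ⟨i, by omega⟩) :
    invCount (w * adjSwap i) + 1 = invCount w := by
  rw [← invCount_mul_adjSwap, mul_adjSwap_mul_adjSwap]
  simpa [adjSwap] using h

theorem eq_one_of_no_descent {n : ℕ} (w : Equiv.Perm (Fin n))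
    (h : ∀ i : Fin (n - 1), ¬ w ⟨i + 1, by omega⟩ < w ⟨i, by omega⟩) : w = 1 := by
  have hm : StrictMono w := by
    cases n with
    | zero => exact fun a => a.elim0
    | succ m =>
      rw [Fin.strictMono_iff_lt_succ]
      intro i
      have h1 := h i
      refine lt_of_le_of_ne (not_lt.1 h1) fun h2 => ?_
      have h3 := w.injective h2
      simp [Fin.ext_iff] at h3
  have h1 : (⟨w, hm.le_iff_le⟩ : Fin n ≃o Fin n) = OrderIso.refl _ := Subsingleton.elim _ _
  ext k
  exact congrArg (fun e : Fin n ≃o Fin n => (e k : ℕ)) h1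

theorem exists_word {n : ℕ} (k : ℕ) (w : Equiv.Perm (Fin n)) (hk : invCount w = k) :
    ∃ a : List (Fin (n - 1)), a.length = k ∧ (a.map adjSwap).prod = w := by
  induction k generalizing w with
  | zero =>
    refine ⟨[], rfl, ?_⟩
    rw [eq_one_of_no_descent w]
    · simp
    · intro i h
      have := invCount_mul_adjSwap' w i h
      omega
  | succ k ih =>
    by_cases h : ∃ i : Fin (n - 1), w ⟨i + 1, by omega⟩ < w ⟨i, by omega⟩
    · obtain ⟨i, h⟩ := h
      have h1 := invCount_mul_adjSwap' w i h
      obtain ⟨a, ha, hw⟩ := ih (w * adjSwap i) (by omega)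
      refine ⟨a ++ [i], by simp [ha], ?_⟩
      simp [hw, mul_adjSwap_mul_adjSwap]
    · rw [not_exists] at h
      have h1 := eq_one_of_no_descent w h
      subst h1
      rw [invCount_one] at hk
      omega

theorem adjSwap_val_ne {n : ℕ} (w : Equiv.Perm (Fin n)) (i : Fin (n - 1)) :
    w ⟨i, by omega⟩ ≠ w ⟨i + 1, by omega⟩ := by
  intro h
  have := w.injective h
  simp at this

theorem invCount_prod_le {n : ℕ} (a : List (Fin (n - 1))) :
    invCount (a.map adjSwap).prod ≤ a.length := by
  induction a using List.reverseRecOn with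
  | nil =>
    rw [List.map_nil, List.prod_nil, invCount_one]
    exact Nat.zero_le _
  | append_singleton a i ih =>
    simp only [List.map_append, List.map_cons, List.map_nil, List.prod_append, List.prod_cons,
      List.prod_nil, mul_one, List.length_append, List.length_cons, List.length_nil]
    rcases lt_or_gt_of_ne (adjSwap_val_ne (a.map adjSwap).prod i) with h | h
    · have := invCount_mul_adjSwap _ i h
      omega
    · have := invCount_mul_adjSwap' _ i h
      omega

theorem length_eq_invCount {n : ℕ} (w : Equiv.Perm (Fin n)) : length w = invCount w := by
  refine le_antisymm (Nat.sInf_le (exists_word _ w rfl)) ?_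
  refine le_csInf ⟨_, exists_word _ w rfl⟩ ?_
  rintro k ⟨a, rfl, rfl⟩
  exact invCount_prod_le a

theorem length_lt_mul_adjSwap_iff {n : ℕ} (w : Equiv.Perm (Fin n)) (i : Fin (n - 1)) :
    length w < length (w * adjSwap i) ↔ w ⟨i, by omega⟩ < w ⟨i + 1, by omega⟩ := by
  rw [length_eq_invCount, length_eq_invCount]
  rcases lt_or_gt_of_ne (adjSwap_val_ne w i) with h | h
  · have := invCount_mul_adjSwap _ i h
    exact ⟨fun _ => h, fun _ => by omega⟩
  · have := invCount_mul_adjSwap' _ i h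
    exact ⟨fun _ => by omega, fun h' => absurd h' h.asymm⟩

theorem schubert_longest (n : ℕ) :
    schubert (longest n) = ∏ i : Fin n, MvPolynomial.X i ^ (n - 1 - (i : ℕ)) := by
  rw [schubert, dif_neg]
  rintro ⟨i, h⟩
  rw [length_lt_mul_adjSwap_iff] at h
  simp only [longest, Fin.revPerm_apply, Fin.lt_def, Fin.val_rev] at h
  omega

theorem dividedDifference_eq {n : ℕ} (i : Fin (n - 1)) {g q : MvPolynomial (Fin n) ℤ}
    (h : g - swapVars i g =
      (MvPolynomial.X ⟨i, by omega⟩ - MvPolynomial.X ⟨i + 1, by omega⟩) * q) :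
    dividedDifference i g = q := by
  rw [dividedDifference_spec] at h
  refine mul_left_cancel₀ ?_ h
  rw [sub_ne_zero]
  intro h1
  simpa using MvPolynomial.X_injective h1

theorem X_sub_X_ne_zero {n : ℕ} {a b : Fin n} (h : (a : ℕ) ≠ b) :
    (MvPolynomial.X a - MvPolynomial.X b : MvPolynomial (Fin n) ℤ) ≠ 0 := by
  rw [sub_ne_zero]
  intro h1
  exact h (congrArg Fin.val (MvPolynomial.X_injective h1))

theorem swapVars_X {n : ℕ} (i : Fin (n - 1)) (k : Fin n) :
    swapVars i (MvPolynomial.X k) = MvPolynomial.X (adjSwap i k) :=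
  MvPolynomial.rename_X _ _

theorem swapVars_sub {n : ℕ} (i : Fin (n - 1)) (f g : MvPolynomial (Fin n) ℤ) :
    swapVars i (f - g) = swapVars i f - swapVars i g := map_sub _ _ _

theorem swapVars_mul {n : ℕ} (i : Fin (n - 1)) (f g : MvPolynomial (Fin n) ℤ) :
    swapVars i (f * g) = swapVars i f * swapVars i g := map_mul _ _ _

theorem swapVars_mul_perm {n : ℕ} (i j : Fin (n - 1)) (g : MvPolynomial (Fin n) ℤ) :
    swapVars i (swapVars j g) = MvPolynomial.rename (adjSwap i * adjSwap j) g :=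
  MvPolynomial.rename_rename _ _ _

theorem swapVars_rename {n : ℕ} (i : Fin (n - 1)) (s : Equiv.Perm (Fin n))
    (g : MvPolynomial (Fin n) ℤ) :
    swapVars i (MvPolynomial.rename s g) = MvPolynomial.rename (adjSwap i * s) g :=
  MvPolynomial.rename_rename _ _ _

theorem swapVars_self {n : ℕ} (i : Fin (n - 1)) (g : MvPolynomial (Fin n) ℤ) :
    swapVars i (swapVars i g) = g := by
  have h : adjSwap i * adjSwap i = 1 := by rw [adjSwap, Equiv.swap_mul_self]
  rw [swapVars_mul_perm, h]
  exact MvPolynomial.rename_id_apply g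

theorem adjSwap_apply_of_ne {n : ℕ} (i : Fin (n - 1)) (k : Fin n) (h1 : (k : ℕ) ≠ i)
    (h2 : (k : ℕ) ≠ i + 1) : adjSwap i k = k :=
  Equiv.swap_apply_of_ne_of_ne (fun h => h1 (congrArg Fin.val h))
    (fun h => h2 (congrArg Fin.val h))

theorem adjSwap_left {n : ℕ} (i : Fin (n - 1)) :
    adjSwap i (⟨i, by omega⟩ : Fin n) = ⟨i + 1, by omega⟩ :=
  Equiv.swap_apply_left _ _

theorem adjSwap_right {n : ℕ} (i : Fin (n - 1)) :
    adjSwap i (⟨i + 1, by omega⟩ : Fin n) = ⟨i, by omega⟩ :=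
  Equiv.swap_apply_right _ _

theorem adjSwap_comm {n : ℕ} (i j : Fin (n - 1)) (h : (i : ℕ) + 1 < j) :
    adjSwap i * adjSwap j = adjSwap j * adjSwap i := by
  have hd : Equiv.Perm.Disjoint (adjSwap i) (adjSwap j) := by
    intro k
    by_cases h1 : (k : ℕ) = i ∨ (k : ℕ) = i + 1
    · exact Or.inr (adjSwap_apply_of_ne _ _ (by omega) (by omega))
    · exact Or.inl (adjSwap_apply_of_ne _ _ (by omega) (by omega))
  exact hd.commute

theorem adjSwap_braid {n : ℕ} (i j : Fin (n - 1)) (h : (i : ℕ) + 1 = j) :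
    adjSwap i * adjSwap j * adjSwap i = adjSwap j * adjSwap i * adjSwap j := by
  obtain ⟨j, hj⟩ := j
  simp only at h
  subst h
  unfold adjSwap
  have hi := i.2
  have h1 : (⟨i, by omega⟩ : Fin n) ≠ ⟨i + 1, by omega⟩ := by simp
  have h2 : (⟨i, by omega⟩ : Fin n) ≠ ⟨i + 1 + 1, by omega⟩ := by
    rw [ne_eq, Fin.ext_iff]
    change ¬ (i : ℕ) = i + 1 + 1
    omega
  have h3 : (⟨i + 1, by omega⟩ : Fin n) ≠ ⟨i + 1 + 1, by omega⟩ := by simp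
  have e1 := Equiv.swap_mul_swap_mul_swap h1 h2
  have e2 := Equiv.swap_mul_swap_mul_swap h3.symm h2.symm
  refine Eq.trans ?_ e1.symm
  rw [Equiv.swap_comm _ (⟨i, by omega⟩ : Fin n)]
  refine Eq.trans ?_ e2
  rw [Equiv.swap_comm (⟨i + 1, by omega⟩ : Fin n) ⟨i, by omega⟩,
    Equiv.swap_comm (⟨i + 1, by omega⟩ : Fin n) ⟨i + 1 + 1, by omega⟩]

theorem dividedDifference_comm {n : ℕ} (i j : Fin (n - 1)) (h : (i : ℕ) + 1 < j)
    (g : MvPolynomial (Fin n) ℤ) :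
    dividedDifference i (dividedDifference j g) =
      dividedDifference j (dividedDifference i g) := by
  refine dividedDifference_eq i ?_
  have h1 := dividedDifference_spec i g
  have h2 := dividedDifference_spec j g
  have h3 := dividedDifference_spec j (dividedDifference i g)
  set p := dividedDifference i g
  set q := dividedDifference j g
  set r := dividedDifference j p
  have hc : swapVars i (swapVars j g) = swapVars j (swapVars i g) := by
    rw [swapVars_mul_perm, swapVars_mul_perm, adjSwap_comm i j h]
  have e1 := congrArg (swapVars j) h1
  have e2 := congrArg (swapVars i) h2
  simp only [swapVars_sub, swapVars_mul, swapVars_X] at e1 e2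
  have a1 : adjSwap j (⟨i, by omega⟩ : Fin n) = ⟨i, by omega⟩ := 
    adjSwap_apply_of_ne _ _ (by simp only; omega) (by simp only; omega)
  have a2 : adjSwap j (⟨i + 1, by omega⟩ : Fin n) = ⟨i + 1, by omega⟩ := 
    adjSwap_apply_of_ne _ _ (by simp only; omega) (by simp only; omega)
  have a3 : adjSwap i (⟨j, by omega⟩ : Fin n) = ⟨j, by omega⟩ := 
    adjSwap_apply_of_ne _ _ (by simp only; omega) (by simp only; omega)
  have a4 : adjSwap i (⟨j + 1, by omega⟩ : Fin n) = ⟨j + 1, by omega⟩ := 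
    adjSwap_apply_of_ne _ _ (by simp only; omega) (by simp only; omega)
  rw [a1, a2] at e1
  rw [a3, a4] at e2
  have hne : (MvPolynomial.X ⟨j, by omega⟩ - MvPolynomial.X ⟨j + 1, by omega⟩ :
      MvPolynomial (Fin n) ℤ) ≠ 0 := X_sub_X_ne_zero (by simp)
  refine mul_left_cancel₀ hne ?_
  linear_combination -h2 + e2 + h1 - e1 + hc +
    (MvPolynomial.X ⟨i, by omega⟩ - MvPolynomial.X ⟨i + 1, by omega⟩) * h3

theorem dividedDifference_braid_aux {n : ℕ} (i j : Fin (n - 1)) (g : MvPolynomial (Fin n) ℤ)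
    {a b c : MvPolynomial (Fin n) ℤ} (ab : a - b ≠ 0) (bc : b - c ≠ 0) (ac : a - c ≠ 0)
    (ia : swapVars i a = b) (ib : swapVars i b = a) (ic : swapVars i c = c)
    (ja : swapVars j a = a) (jb : swapVars j b = c) (jc : swapVars j c = b)
    (si : ∀ f, f - swapVars i f = (a - b) * dividedDifference i f)
    (sj : ∀ f, f - swapVars j f = (b - c) * dividedDifference j f)
    (hbp : adjSwap i * adjSwap j * adjSwap i = adjSwap j * adjSwap i * adjSwap j) :
    dividedDifference i (dividedDifference j (dividedDifference i g)) =
      dividedDifference j (dividedDifference i (dividedDifference j g)) := by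
  have hbr : swapVars i (swapVars j (swapVars i g)) = swapVars j (swapVars i (swapVars j g)) := by
    rw [swapVars_mul_perm j i, swapVars_mul_perm i j, swapVars_rename, swapVars_rename,
      ← mul_assoc, ← mul_assoc, hbp]
  have p1 := si g
  have p2 := sj (dividedDifference i g)
  have p3 := si (dividedDifference j (dividedDifference i g))
  have q1 := sj g
  have q2 := si (dividedDifference j g)
  have q3 := sj (dividedDifference i (dividedDifference j g))
  generalize dividedDifference i (dividedDifference j (dividedDifference i g)) = r at *
  generalize dividedDifference j (dividedDifference i (dividedDifference j g)) = r' at *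
  generalize dividedDifference j (dividedDifference i g) = q at *
  generalize dividedDifference i (dividedDifference j g) = q' at *
  generalize dividedDifference i g = p at *
  generalize dividedDifference j g = p' at *
  have P1 := congrArg (swapVars j) p1
  simp only [swapVars_sub, swapVars_mul, ja, jb] at P1
  have P2 : (a - b) * (a - c) * (b - c) * q =
      (a - c) * (g - swapVars i g) - (a - b) * (swapVars j g - swapVars j (swapVars i g)) := by
    linear_combination -(a - b) * (a - c) * p2 - (a - c) * p1 + (a - b) * P1
  have P3 := congrArg (swapVars i) P2
  simp only [swapVars_sub, swapVars_mul, ia, ib, ic, swapVars_self] at P3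
  have Q1 := congrArg (swapVars i) q1
  simp only [swapVars_sub, swapVars_mul, ib, ic] at Q1
  have Q2 : (a - b) * (a - c) * (b - c) * q' =
      (a - c) * (g - swapVars j g) - (b - c) * (swapVars i g - swapVars i (swapVars j g)) := by
    linear_combination -(b - c) * (a - c) * q2 - (a - c) * q1 + (b - c) * Q1
  have Q3 := congrArg (swapVars j) Q2
  simp only [swapVars_sub, swapVars_mul, ja, jb, jc, swapVars_self] at Q3
  have hV : (a - b) * (a - b) * (a - c) * (b - c) * (b - c) ≠ 0 := by
    simp only [ne_eq, mul_eq_zero, not_or]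
    exact ⟨⟨⟨⟨ab, ab⟩, ac⟩, bc⟩, bc⟩
  refine mul_left_cancel₀ hV ?_
  linear_combination (b - c) * P2 + (b - c) * P3 - (a - b) * (a - c) * (b - c) * (b - c) * p3
    - (a - b) * Q2 - (a - b) * Q3 + (a - b) * (a - c) * (b - c) * (a - b) * q3
    - (a - b) * (b - c) * hbr

theorem dividedDifference_braid {n : ℕ} (i j : Fin (n - 1)) (h : (i : ℕ) + 1 = j)
    (g : MvPolynomial (Fin n) ℤ) :
    dividedDifference i (dividedDifference j (dividedDifference i g)) =
      dividedDifference j (dividedDifference i (dividedDifference j g)) := by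
  obtain ⟨j, hj⟩ := j
  simp only at h
  subst h
  have hi := i.2
  have ab := X_sub_X_ne_zero (n := n) (a := ⟨i, by omega⟩) (b := ⟨i + 1, by omega⟩)
    (by simp only; omega)
  have bc := X_sub_X_ne_zero (n := n) (a := ⟨i + 1, by omega⟩) (b := ⟨i + 1 + 1, by omega⟩)
    (by simp only; omega)
  have ac := X_sub_X_ne_zero (n := n) (a := ⟨i, by omega⟩) (b := ⟨i + 1 + 1, by omega⟩)
    (by simp only; omega)
  have ia := swapVars_X i ⟨i, by omega⟩
  have ib := swapVars_X i ⟨i + 1, by omega⟩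
  have ic := swapVars_X i ⟨i + 1 + 1, by omega⟩
  have ja := swapVars_X ⟨i + 1, hj⟩ ⟨i, by omega⟩
  have jb := swapVars_X ⟨i + 1, hj⟩ ⟨i + 1, by omega⟩
  have jc := swapVars_X ⟨i + 1, hj⟩ ⟨i + 1 + 1, by omega⟩
  rw [adjSwap_left] at ia
  rw [adjSwap_right] at ib
  rw [adjSwap_apply_of_ne _ _ (by simp only; omega) (by simp only; omega)] at ic ja
  rw [show adjSwap ⟨i + 1, hj⟩ (⟨i + 1, by omega⟩ : Fin n) = ⟨i + 1 + 1, by omega⟩ from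
    adjSwap_left ⟨i + 1, hj⟩] at jb
  rw [show adjSwap ⟨i + 1, hj⟩ (⟨i + 1 + 1, by omega⟩ : Fin n) = ⟨i + 1, by omega⟩ from
    adjSwap_right ⟨i + 1, hj⟩] at jc
  have si := dividedDifference_spec i
  have sj := dividedDifference_spec ⟨i + 1, hj⟩
  have hbp := adjSwap_braid i ⟨i + 1, hj⟩ rfl
  exact dividedDifference_braid_aux i ⟨i + 1, hj⟩ g ab bc ac ia ib ic ja jb jc si sj hbp

/-- The recursion for Schubert polynomials, for every `i` with `ℓ(w s_i) > ℓ(w)`. -/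
theorem schubert_ascent {n : ℕ} (w : Equiv.Perm (Fin n)) (i : Fin (n - 1))
    (h : length w < length (w * adjSwap i)) :
    schubert w = dividedDifference i (schubert (w * adjSwap i)) := by
  obtain ⟨k, hk⟩ : ∃ k, Finset.univ.sup (length (n := n)) - length w = k := ⟨_, rfl⟩
  induction k using Nat.strong_induction_on generalizing w i with
  | _ k ih =>
  have IH : ∀ j : Fin (n - 1), length w < length (w * adjSwap j) → ∀ l : Fin (n - 1),
      length (w * adjSwap j) < length (w * adjSwap j * adjSwap l) →
      schubert (w * adjSwap j) =
        dividedDifference l (schubert (w * adjSwap j * adjSwap l)) := by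
    intro j hj l hl
    have h2 := Finset.le_sup (f := length (n := n)) (Finset.mem_univ (w * adjSwap j))
    exact ih _ (by omega) (w * adjSwap j) l hl rfl
  have far : ∀ j l : Fin (n - 1), length w < length (w * adjSwap j) →
      length w < length (w * adjSwap l) → (j : ℕ) + 1 < l →
      dividedDifference j (schubert (w * adjSwap j)) =
        dividedDifference l (schubert (w * adjSwap l)) := by
    intro j l hj hl hjl
    have hj' := hj
    have hl' := hl
    rw [length_lt_mul_adjSwap_iff] at hj' hl'
    have c1 : length (w * adjSwap j) < length (w * adjSwap j * adjSwap l) := by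
      rw [length_lt_mul_adjSwap_iff]
      rw [Equiv.Perm.mul_apply, Equiv.Perm.mul_apply,
        adjSwap_apply_of_ne _ _ (by simp only; omega) (by simp only; omega),
        adjSwap_apply_of_ne _ _ (by simp only; omega) (by simp only; omega)]
      assumption
    have c2 : length (w * adjSwap l) < length (w * adjSwap l * adjSwap j) := by
      rw [length_lt_mul_adjSwap_iff]
      rw [Equiv.Perm.mul_apply, Equiv.Perm.mul_apply,
        adjSwap_apply_of_ne _ _ (by simp only; omega) (by simp only; omega),
        adjSwap_apply_of_ne _ _ (by simp only; omega) (by simp only; omega)]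
      assumption
    rw [IH j hj l c1, IH l hl j c2, dividedDifference_comm j l hjl, mul_assoc, mul_assoc,
      adjSwap_comm j l hjl]
  have near : ∀ j l : Fin (n - 1), length w < length (w * adjSwap j) →
      length w < length (w * adjSwap l) → (j : ℕ) + 1 = l →
      dividedDifference j (schubert (w * adjSwap j)) =
        dividedDifference l (schubert (w * adjSwap l)) := by
    intro j l hj hl hjl
    have hbr := adjSwap_braid j l hjl
    have hdd := dividedDifference_braid j l hjl
    obtain ⟨l, hl0⟩ := l
    simp only at hjl
    subst hjl
    set l : Fin (n - 1) := ⟨j + 1, hl0⟩ with hldef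
    have hj' := hj
    have hl' := hl
    rw [length_lt_mul_adjSwap_iff] at hj' hl'
    set x : Fin n := ⟨j, by omega⟩ with hx
    set y : Fin n := ⟨j + 1, by omega⟩ with hy
    set z : Fin n := ⟨j + 1 + 1, by omega⟩ with hz
    have jx : adjSwap j x = y := adjSwap_left j
    have jy : adjSwap j y = x := adjSwap_right j
    have jz : adjSwap j z = z :=
      adjSwap_apply_of_ne _ _ (by simp only [hz]; omega) (by simp only [hz]; omega)
    have lx : adjSwap l x = x :=
      adjSwap_apply_of_ne _ _ (by simp only [hx, hldef]; omega) (by simp only [hx, hldef]; omega)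
    have ly : adjSwap l y = z := adjSwap_left l
    have lz : adjSwap l z = y := adjSwap_right l
    have hxy : w x < w y := hj'
    have hyz : w y < w z := hl'
    have asc_j : ∀ u : Equiv.Perm (Fin n), u x < u y → length u < length (u * adjSwap j) :=
      fun u hu => (length_lt_mul_adjSwap_iff u j).2 hu
    have asc_l : ∀ u : Equiv.Perm (Fin n), u y < u z → length u < length (u * adjSwap l) :=
      fun u hu => (length_lt_mul_adjSwap_iff u l).2 hu
    have sup : ∀ u : Equiv.Perm (Fin n),
        length u ≤ Finset.univ.sup (length (n := n)) :=
      fun u => Finset.le_sup (Finset.mem_univ u)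
    have c1 := asc_l (w * adjSwap j)
      (by simpa only [Equiv.Perm.mul_apply, jy, jz] using hxy.trans hyz)
    have c2 := asc_j (w * adjSwap j * adjSwap l)
      (by simpa only [Equiv.Perm.mul_apply, jx, jz, lx, ly] using hyz)
    have d1 := asc_j (w * adjSwap l)
      (by simpa only [Equiv.Perm.mul_apply, lx, ly] using hxy.trans hyz)
    have d2 := asc_l (w * adjSwap l * adjSwap j)
      (by simpa only [Equiv.Perm.mul_apply, jy, jz, lx, lz] using hxy)
    have s1 := sup (w * adjSwap j * adjSwap l)
    have s2 := sup (w * adjSwap l * adjSwap j)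
    have e1 := ih _ (by omega) (w * adjSwap j * adjSwap l) j c2 rfl
    have e2 := ih _ (by omega) (w * adjSwap l * adjSwap j) l d2 rfl
    rw [IH j hj l c1, IH l hl j d1, e1, e2, hdd]
    simp only [mul_assoc] at hbr ⊢
    rw [hbr]
  have hex : ∃ i : Fin (n - 1), length w < length (w * adjSwap i) := ⟨i, h⟩
  have hdef : schubert w =
      dividedDifference hex.choose (schubert (w * adjSwap hex.choose)) := by
    rw [schubert, dif_pos hex]
  have hm := hex.choose_spec
  rw [hdef]
  generalize hex.choose = m at *
  rcases lt_trichotomy (m : ℕ) i with hlt | heq | hgt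
  · rcases Nat.lt_or_ge (m + 1) i with h1 | h1
    · exact far m i hm h h1
    · exact near m i hm h (by omega)
  · rw [Fin.ext heq]
  · rcases Nat.lt_or_ge (i + 1) m with h1 | h1
    · exact (far i m h hm h1).symm
    · exact (near i m h hm (by omega)).symm

/-- `𝔖_{w s_i} = N_i 𝔖_w` whenever `ℓ(w s_i) < ℓ(w)`. -/
theorem schubert_mul_adjSwap {n : ℕ} (w : Equiv.Perm (Fin n)) (i : Fin (n - 1))
    (h : length (w * adjSwap i) < length w) :
    schubert (w * adjSwap i) = dividedDifference i (schubert w) := by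
  have := schubert_ascent (w * adjSwap i) i (by rwa [mul_adjSwap_mul_adjSwap])
  rwa [mul_adjSwap_mul_adjSwap] at this

end BruhatChains

/-! ### Idea of the proof

Write `f(w) = 𝔖_w(1, …, 1)` and `N = n(n-1)/2`. Splitting off the first step of a chain reduces the
theorem, by descending induction on the length, to the identity
`(N - ℓ(v)) f(v) = ∑ wt(v ⋖ u) f(u)`, the sum being over the covers `u` of `v`
(`sum_coverPairs_macdonaldWeight`). The weight at `z` is the combination of `1 + 2b` and `1 + 2c`
with coefficients `1 - z/2` and `z/2`, so it is enough to treat these two weights.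

For `1 + 2b`, the operator `D = ∑ ρ_j x_j - ∑ x_j² ∂/∂x_j`, where `ρ = (n-1, …, 1, 0)`, satisfies
`D 𝔖_v = ∑ (1 + 2 b_{v ⋖ u}) 𝔖_u` (`strong_order_expansion`); at `x = (1, …, 1)` this is the
identity wanted, as `𝔖_v` is homogeneous of degree `ℓ(v)`. The expansion descends from `w₀` by
divided differences. If `v` has an ascent at `i`, then the covers of `v` other than `v s_i`
correspond to the covers of `v s_i` with a descent at `i` (`sum_coverPairs_of_ascent`), and the
commutator of `D` and `N_i` contributes `2 x_i 𝔖_v`, which by Monk's rule (`monk`) accounts exactly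
for the change of the numbers `b` (`bPair_mul_adjSwap`). The expansion of `x_i 𝔖_v` stays inside
`S_n` because `v_i < v_{i+1}`.

The weight `1 + 2c` is the weight `1 + 2b` of the inverse permutations, so it remains to see that
`f(w⁻¹) = f(w)` (`schubertOne_inv`). The operator `∑ ∂/∂x_j` commutes with all `N_i` and expands
`𝔖_w` along the left weak order (`powDeriv_zero_schubert`), which gives
`ℓ(w) f(w) = ∑ k f(s_k w)` over the left descents `k`. The same recursion then holds on the right,
and both determine `f`. -/

namespace BruhatChains

/-! ### Lengths, ascents and covers -/

/-- The left position `i` of the adjacent transposition `s_i`. -/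
abbrev lo {n : ℕ} (i : Fin (n - 1)) : Fin n := ⟨i, by omega⟩

/-- The right position `i + 1` of the adjacent transposition `s_i`. -/
abbrev hi {n : ℕ} (i : Fin (n - 1)) : Fin n := ⟨i + 1, by omega⟩

theorem val_lo {n : ℕ} (i : Fin (n - 1)) : (lo i : ℕ) = i := rfl

theorem val_hi {n : ℕ} (i : Fin (n - 1)) : (hi i : ℕ) = i + 1 := rfl

theorem lo_lt_hi {n : ℕ} (i : Fin (n - 1)) : lo i < hi i := by
  rw [Fin.lt_def]; simp

theorem hi_lt_of_lo_lt {n : ℕ} {i : Fin (n - 1)} {k : Fin n} (h : lo i < k) (h' : k ≠ hi i) :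
    hi i < k :=
  lt_of_le_of_ne (Fin.le_def.2 (Nat.succ_le_of_lt (Fin.lt_def.1 h))) h'.symm

theorem lt_lo_of_lt_hi {n : ℕ} {i : Fin (n - 1)} {k : Fin n} (h : k < hi i) (h' : k ≠ lo i) :
    k < lo i :=
  lt_of_le_of_ne (Fin.le_def.2 (Nat.le_of_lt_succ (Fin.lt_def.1 h))) h'

theorem adjSwap_lo {n : ℕ} (i : Fin (n - 1)) : adjSwap i (lo i) = hi i := adjSwap_left i

theorem adjSwap_hi {n : ℕ} (i : Fin (n - 1)) : adjSwap i (hi i) = lo i := adjSwap_right i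

theorem adjSwap_of_ne {n : ℕ} (i : Fin (n - 1)) {k : Fin n} (h1 : k ≠ lo i) (h2 : k ≠ hi i) :
    adjSwap i k = k := Equiv.swap_apply_of_ne_of_ne h1 h2

theorem adjSwap_adjSwap {n : ℕ} (i : Fin (n - 1)) (k : Fin n) : adjSwap i (adjSwap i k) = k :=
  Equiv.swap_apply_self _ _ _

theorem adjSwap_inv {n : ℕ} (i : Fin (n - 1)) : (adjSwap i)⁻¹ = adjSwap i := Equiv.swap_inv _ _

/-- An adjacent transposition preserves the order of every pair of positions but its own. -/
theorem adjSwap_lt_adjSwap {n : ℕ} (i : Fin (n - 1)) {a b : Fin n} (h : a < b)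
    (hne : ¬ (a = lo i ∧ b = hi i)) : adjSwap i a < adjSwap i b := by
  unfold adjSwap
  rw [Equiv.swap_apply_def, Equiv.swap_apply_def]
  simp only [Fin.ext_iff, Fin.lt_def] at *
  split_ifs <;> (try simp only) <;> omega

theorem length_mul_adjSwap {n : ℕ} (w : Equiv.Perm (Fin n)) (i : Fin (n - 1))
    (h : w (lo i) < w (hi i)) : length (w * adjSwap i) = length w + 1 := by
  rw [length_eq_invCount, length_eq_invCount, invCount_mul_adjSwap w i h]

theorem length_mul_adjSwap' {n : ℕ} (w : Equiv.Perm (Fin n)) (i : Fin (n - 1))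
    (h : w (hi i) < w (lo i)) : length (w * adjSwap i) + 1 = length w := by
  rw [length_eq_invCount, length_eq_invCount, invCount_mul_adjSwap' w i h]

theorem length_mul_adjSwap_lt_iff {n : ℕ} (w : Equiv.Perm (Fin n)) (i : Fin (n - 1)) :
    length (w * adjSwap i) < length w ↔ w (hi i) < w (lo i) := by
  rcases lt_or_gt_of_ne (adjSwap_val_ne w i) with h | h
  · have := length_mul_adjSwap w i h
    exact ⟨fun _ => by omega, fun h' => absurd h h'.asymm⟩
  · have := length_mul_adjSwap' w i h
    exact ⟨fun _ => h, fun _ => by omega⟩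

theorem length_mul_adjSwap_cases {n : ℕ} (w : Equiv.Perm (Fin n)) (i : Fin (n - 1)) :
    length (w * adjSwap i) = length w + 1 ∨ length (w * adjSwap i) + 1 = length w := by
  rcases lt_or_gt_of_ne (adjSwap_val_ne w i) with h | h
  · exact Or.inl (length_mul_adjSwap w i h)
  · exact Or.inr (length_mul_adjSwap' w i h)

theorem length_inv {n : ℕ} (w : Equiv.Perm (Fin n)) : length w⁻¹ = length w := by
  have key : ∀ u : Equiv.Perm (Fin n), length u⁻¹ ≤ length u := by
    intro u
    obtain ⟨a, ha, hw⟩ := exists_word _ u rfl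
    rw [length_eq_invCount u, ← ha]
    refine Nat.sInf_le ⟨a.reverse, List.length_reverse, ?_⟩
    rw [← hw, List.prod_inv_reverse, List.map_reverse, List.map_map]
    congr 2
  exact le_antisymm (key w) (by simpa using key w⁻¹)

theorem length_adjSwap_mul_cases {n : ℕ} (w : Equiv.Perm (Fin n)) (i : Fin (n - 1)) :
    length (adjSwap i * w) = length w + 1 ∨ length (adjSwap i * w) + 1 = length w := by
  have h := length_mul_adjSwap_cases w⁻¹ i
  rwa [← length_inv (w⁻¹ * adjSwap i), mul_inv_rev, adjSwap_inv, inv_inv, length_inv] at h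

/-- Exchanging an ascending pair of entries increases the length. The transposition `(a b)` is
the product of `s_a`, `(a + 1, b)` and `s_a`; the two outer factors change the length by `1` each,
and do not both decrease it. -/
theorem length_lt_mul_swap {n : ℕ} (v : Equiv.Perm (Fin n)) {a b : Fin n} (hab : a < b)
    (hv : v a < v b) : length v < length (v * Equiv.swap a b) := by
  obtain ⟨d, hd⟩ : ∃ d, (b : ℕ) = a + 1 + d := ⟨b - (a + 1), by rw [Fin.lt_def] at hab; omega⟩
  induction d generalizing v a with
  | zero =>
    have hb := b.2
    have h := length_mul_adjSwap v ⟨a, by omega⟩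
      (by convert hv using 2; exact Fin.ext (by simp only; omega))
    have e : adjSwap ⟨a, by omega⟩ = Equiv.swap a b := by
      unfold adjSwap
      congr 1
      exact Fin.ext (by simp only; omega)
    rw [e] at h
    omega
  | succ d ih =>
    have hb := b.2
    let i : Fin (n - 1) := ⟨a, by omega⟩
    have ha : lo i = a := rfl
    have hib : hi i < b := by rw [Fin.lt_def]; simp only [i]; omega
    have hb1 : b ≠ lo i := by rw [ha]; exact hab.ne'
    have hsb : adjSwap i b = b := adjSwap_of_ne i hb1 hib.ne'
    have e : v * Equiv.swap a b = v * adjSwap i * Equiv.swap (hi i) b * adjSwap i := by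
      have := Equiv.swap_apply_apply (adjSwap i) (hi i) b
      rw [adjSwap_hi, hsb, ha, adjSwap_inv] at this
      rw [this]
      simp only [mul_assoc]
    have h2 := ih (v * adjSwap i) hib
      (by rw [Equiv.Perm.mul_apply, Equiv.Perm.mul_apply, adjSwap_hi, hsb, ha]; exact hv)
      (by simp only [i]; omega)
    rw [e]
    set u := v * adjSwap i * Equiv.swap (hi i) b with hu
    have hu1 : u (lo i) = v (hi i) := by
      rw [hu, Equiv.Perm.mul_apply, Equiv.Perm.mul_apply,
        Equiv.swap_apply_of_ne_of_ne (lo_lt_hi i).ne hb1.symm, adjSwap_lo]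
    have hu2 : u (hi i) = v b := by
      rw [hu, Equiv.Perm.mul_apply, Equiv.Perm.mul_apply, Equiv.swap_apply_left, hsb]
    by_cases h3 : v (hi i) < v b
    · have h4 := length_mul_adjSwap u i (by rw [hu1, hu2]; exact h3)
      have h5 := length_mul_adjSwap_cases v i
      omega
    · have h4 := length_mul_adjSwap_cases u i
      have h5 := length_mul_adjSwap v i (by rw [ha]; exact hv.trans_le (not_lt.1 h3))
      omega

/-- The pairs of positions `a < b` for which `v t_{ab}` covers `v`. -/
noncomputable def coverPairs {n : ℕ} (v : Equiv.Perm (Fin n)) : Finset (Fin n × Fin n) :=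
  Finset.univ.filter fun p => p.1 < p.2 ∧ length (v * Equiv.swap p.1 p.2) = length v + 1

theorem mem_coverPairs {n : ℕ} {v : Equiv.Perm (Fin n)} {p : Fin n × Fin n} :
    p ∈ coverPairs v ↔ p.1 < p.2 ∧ length (v * Equiv.swap p.1 p.2) = length v + 1 := by
  simp [coverPairs]

theorem coverPairs_lt {n : ℕ} {v : Equiv.Perm (Fin n)} {p : Fin n × Fin n}
    (hp : p ∈ coverPairs v) : v p.1 < v p.2 := by
  rw [mem_coverPairs] at hp
  by_contra h
  have h1 : v p.2 < v p.1 :=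
    lt_of_le_of_ne (not_lt.1 h) fun e => hp.1.ne (v.injective e).symm
  have h2 := length_lt_mul_swap (v * Equiv.swap p.1 p.2) hp.1 (by simpa using h1)
  rw [mul_assoc, Equiv.swap_mul_self, mul_one] at h2
  omega

/-- In a cover `v ⋖ v t_{ab}` no value between `v_a` and `v_b` occurs between the positions `a`
and `b`: otherwise `t_{ab} = t_{ak} t_{kb} t_{ak}` would raise the length at least three times. -/
theorem coverPairs_not_between {n : ℕ} {v : Equiv.Perm (Fin n)} {p : Fin n × Fin n}
    (hp : p ∈ coverPairs v) {k : Fin n} (h1 : p.1 < k) (h2 : k < p.2) (h3 : v p.1 < v k) :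
    v p.2 < v k := by
  by_contra h
  have h4 : v k < v p.2 := lt_of_le_of_ne (not_lt.1 h) fun e => h2.ne (v.injective e)
  rw [mem_coverPairs] at hp
  obtain ⟨a, b⟩ := p
  simp only at *
  have e : Equiv.swap a b = Equiv.swap a k * Equiv.swap k b * Equiv.swap a k := by
    have := Equiv.swap_apply_apply (Equiv.swap a k) k b
    rwa [Equiv.swap_apply_right, Equiv.swap_apply_of_ne_of_ne hp.1.ne' h2.ne', Equiv.swap_inv]
      at this
  have s1 := length_lt_mul_swap v h1 h3
  have s2 := length_lt_mul_swap (v * Equiv.swap a k) h2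
    (by simpa [Equiv.swap_apply_of_ne_of_ne hp.1.ne' h2.ne'] using h3.trans h4)
  have s3 := length_lt_mul_swap (v * Equiv.swap a k * Equiv.swap k b) h1
    (by simpa [Equiv.swap_apply_of_ne_of_ne hp.1.ne' h2.ne',
          Equiv.swap_apply_of_ne_of_ne h1.ne hp.1.ne] using h4)
  rw [show v * Equiv.swap a k * Equiv.swap k b * Equiv.swap a k = v * Equiv.swap a b by
    rw [e]; simp only [mul_assoc]] at s3
  omega

theorem exists_ascent {n : ℕ} {v : Equiv.Perm (Fin n)} (h : v ≠ longest n) :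
    ∃ i : Fin (n - 1), v (lo i) < v (hi i) := by
  by_contra hc
  push Not at hc
  refine h ?_
  have h1 := eq_one_of_no_descent (longest n * v) fun i hi' => by
    simp only [longest, Equiv.Perm.mul_apply, Fin.revPerm_apply, Fin.rev_lt_rev] at hi'
    exact absurd (hc i) (not_le.2 hi')
  have h2 : longest n * longest n = 1 := by ext; simp [longest]
  calc v = longest n * (longest n * v) := by rw [← mul_assoc, h2, one_mul]
    _ = longest n := by rw [h1, mul_one]

/-- Descending induction on the length. -/
theorem length_desc_induction {n : ℕ} {P : Equiv.Perm (Fin n) → Prop}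
    (h : ∀ v, (∀ u, length v < length u → P u) → P v) (v : Equiv.Perm (Fin n)) : P v := by
  obtain ⟨k, hk⟩ : ∃ k, Finset.univ.sup (length (n := n)) - length v = k := ⟨_, rfl⟩
  induction k using Nat.strong_induction_on generalizing v with
  | _ k ih =>
    refine h v fun u hu => ih _ ?_ u rfl
    have := Finset.le_sup (f := length (n := n)) (Finset.mem_univ u)
    omega

/-- Induction from `w₀` downwards in the right weak order. -/
theorem ascent_induction {n : ℕ} {P : Equiv.Perm (Fin n) → Prop} (h0 : P (longest n))
    (step : ∀ v i, v (lo i) < v (hi i) → P (v * adjSwap i) → P v) (v : Equiv.Perm (Fin n)) :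
    P v := by
  refine length_desc_induction (fun v ih => ?_) v
  by_cases hv : v = longest n
  · rwa [hv]
  · obtain ⟨i, hi'⟩ := exists_ascent hv
    exact step v i hi' (ih _ (by rw [length_mul_adjSwap v i hi']; omega))

/-! ### Divided differences of products and of Schubert polynomials -/

theorem dividedDifference_mul {n : ℕ} (i : Fin (n - 1)) (f g : MvPolynomial (Fin n) ℤ) :
    dividedDifference i (f * g) =
      dividedDifference i f * g + swapVars i f * dividedDifference i g := by
  refine dividedDifference_eq i ?_
  have h1 := dividedDifference_spec i f
  have h2 := dividedDifference_spec i g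
  rw [swapVars_mul]
  linear_combination g * h1 + swapVars i f * h2

theorem dividedDifference_add {n : ℕ} (i : Fin (n - 1)) (f g : MvPolynomial (Fin n) ℤ) :
    dividedDifference i (f + g) = dividedDifference i f + dividedDifference i g := by
  refine dividedDifference_eq i ?_
  have h1 := dividedDifference_spec i f
  have h2 := dividedDifference_spec i g
  rw [show swapVars i (f + g) = swapVars i f + swapVars i g from map_add _ _ _]
  linear_combination h1 + h2

/-- The divided difference `N_i` as an additive map. -/
noncomputable def dividedDifferenceHom {n : ℕ} (i : Fin (n - 1)) :
    MvPolynomial (Fin n) ℤ →+ MvPolynomial (Fin n) ℤ :=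
  AddMonoidHom.mk' (dividedDifference i) (dividedDifference_add i)

theorem dividedDifference_zsmul {n : ℕ} (i : Fin (n - 1)) (c : ℤ) (g : MvPolynomial (Fin n) ℤ) :
    dividedDifference i (c • g) = c • dividedDifference i g :=
  map_zsmul (dividedDifferenceHom i) c g

theorem dividedDifference_sub {n : ℕ} (i : Fin (n - 1)) (f g : MvPolynomial (Fin n) ℤ) :
    dividedDifference i (f - g) = dividedDifference i f - dividedDifference i g :=
  map_sub (dividedDifferenceHom i) f g

theorem dividedDifference_sum {n : ℕ} {ι : Type*} (i : Fin (n - 1)) (s : Finset ι)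
    (f : ι → MvPolynomial (Fin n) ℤ) :
    dividedDifference i (∑ k ∈ s, f k) = ∑ k ∈ s, dividedDifference i (f k) :=
  map_sum (dividedDifferenceHom i) f s

theorem dividedDifference_of_symm {n : ℕ} (i : Fin (n - 1)) {g : MvPolynomial (Fin n) ℤ}
    (h : swapVars i g = g) : dividedDifference i g = 0 :=
  dividedDifference_eq i (by rw [h, sub_self, mul_zero])

theorem swapVars_dividedDifference {n : ℕ} (i : Fin (n - 1)) (g : MvPolynomial (Fin n) ℤ) :
    swapVars i (dividedDifference i g) = dividedDifference i g := by
  have h := dividedDifference_spec i g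
  have h2 := congrArg (swapVars i) h
  simp only [swapVars_sub, swapVars_mul, swapVars_self, swapVars_X] at h2
  rw [show adjSwap i ⟨i, by omega⟩ = hi i from adjSwap_lo i,
    show adjSwap i ⟨i + 1, by omega⟩ = lo i from adjSwap_hi i] at h2
  refine mul_left_cancel₀ (X_sub_X_ne_zero (a := lo i) (b := hi i) (by simp)) ?_
  linear_combination h + h2

theorem dividedDifference_dividedDifference {n : ℕ} (i : Fin (n - 1))
    (g : MvPolynomial (Fin n) ℤ) : dividedDifference i (dividedDifference i g) = 0 :=
  dividedDifference_of_symm i (swapVars_dividedDifference i g)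

/-- The coefficient of `𝔖_{v t_{ab}}` in Monk's expansion of `x_r 𝔖_v`: it is `1` if `a = r`,
`-1` if `b = r`, and `0` otherwise. -/
def monkCoeff {n : ℕ} (r : Fin n) (p : Fin n × Fin n) : ℤ :=
  (if p.1 = r then 1 else 0) - (if p.2 = r then 1 else 0)

theorem dividedDifference_X {n : ℕ} (i : Fin (n - 1)) (r : Fin n) :
    dividedDifference i (MvPolynomial.X r) = MvPolynomial.C (monkCoeff r (lo i, hi i)) := by
  refine dividedDifference_eq i ?_
  rw [swapVars_X]
  have h := (lo_lt_hi i).ne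
  unfold monkCoeff
  by_cases h1 : r = lo i
  · subst h1
    simp [adjSwap_lo, h.symm]
  · by_cases h2 : r = hi i
    · subst h2
      simp [adjSwap_hi, h]
    · simp [adjSwap_of_ne i h1 h2, Ne.symm h1, Ne.symm h2]

theorem schubert_eq_dividedDifference {n : ℕ} (v : Equiv.Perm (Fin n)) (i : Fin (n - 1))
    (h : v (lo i) < v (hi i)) : schubert v = dividedDifference i (schubert (v * adjSwap i)) :=
  schubert_ascent v i ((length_lt_mul_adjSwap_iff v i).2 h)

theorem dividedDifference_schubert {n : ℕ} (v : Equiv.Perm (Fin n)) (i : Fin (n - 1)) :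
    dividedDifference i (schubert v) =
      if v (hi i) < v (lo i) then schubert (v * adjSwap i) else 0 := by
  split_ifs with h
  · exact (schubert_mul_adjSwap v i ((length_mul_adjSwap_lt_iff v i).2 h)).symm
  · have h1 : v (lo i) < v (hi i) := lt_of_le_of_ne (not_lt.1 h) (adjSwap_val_ne v i)
    rw [schubert_eq_dividedDifference v i h1, dividedDifference_dividedDifference]

/-! ### Covers along a step in the weak order -/

theorem coverPairs_ascent {n : ℕ} {v : Equiv.Perm (Fin n)} {i : Fin (n - 1)}
    (h : v (lo i) < v (hi i)) {p : Fin n × Fin n} (hp : p ∈ coverPairs v)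
    (hne : p ≠ (lo i, hi i)) :
    (v * Equiv.swap p.1 p.2) (lo i) < (v * Equiv.swap p.1 p.2) (hi i) := by
  have h1 := coverPairs_lt hp
  have h2 := fun k => coverPairs_not_between hp (k := k)
  have h3 := (mem_coverPairs.1 hp).1
  obtain ⟨a, b⟩ := p
  have hlh := lo_lt_hi i
  rw [Equiv.Perm.mul_apply, Equiv.Perm.mul_apply]
  simp only [ne_eq, Prod.mk.injEq] at *
  by_cases ha : a = lo i
  · subst ha
    have hb : b ≠ hi i := fun e => hne ⟨rfl, e⟩
    rw [Equiv.swap_apply_left, Equiv.swap_apply_of_ne_of_ne hlh.ne' hb.symm]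
    exact h2 _ hlh (hi_lt_of_lo_lt h3 hb) h
  by_cases ha' : a = hi i
  · subst ha'
    rw [Equiv.swap_apply_left, Equiv.swap_apply_of_ne_of_ne hlh.ne (hlh.trans h3).ne]
    exact h.trans h1
  by_cases hb : b = lo i
  · subst hb
    rw [Equiv.swap_apply_right, Equiv.swap_apply_of_ne_of_ne (Ne.symm ha') hlh.ne']
    exact h1.trans h
  by_cases hb' : b = hi i
  · subst hb'
    rw [Equiv.swap_apply_right, Equiv.swap_apply_of_ne_of_ne (Ne.symm ha) hlh.ne]
    by_contra hc
    exact absurd (h2 (lo i) (lt_lo_of_lt_hi h3 ha) hlh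
      (lt_of_le_of_ne (not_lt.1 hc) (v.injective.ne ha))) h.asymm
  rwa [Equiv.swap_apply_of_ne_of_ne (Ne.symm ha) (Ne.symm hb),
    Equiv.swap_apply_of_ne_of_ne (Ne.symm ha') (Ne.symm hb')]

theorem mul_swap_conj {n : ℕ} (v : Equiv.Perm (Fin n)) (i : Fin (n - 1)) (a b : Fin n) :
    v * adjSwap i * Equiv.swap (adjSwap i a) (adjSwap i b) =
      v * Equiv.swap a b * adjSwap i := by
  rw [Equiv.swap_apply_apply, adjSwap_inv]
  simp only [← mul_assoc, mul_adjSwap_mul_adjSwap]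

theorem lo_hi_mem_coverPairs {n : ℕ} {v : Equiv.Perm (Fin n)} {i : Fin (n - 1)}
    (h : v (lo i) < v (hi i)) : (lo i, hi i) ∈ coverPairs v :=
  mem_coverPairs.2 ⟨lo_lt_hi i, length_mul_adjSwap v i h⟩

/-- The covers of `v` other than `v s_i` correspond, via conjugation of the transposition by
`s_i`, to the covers of `w = v s_i` that have a descent at `i`; and `N_i` kills the Schubert
polynomials of the other covers of `w`. -/
theorem sum_coverPairs_of_ascent {n : ℕ} {v : Equiv.Perm (Fin n)} {i : Fin (n - 1)}
    (h : v (lo i) < v (hi i)) (c d : Fin n × Fin n → ℤ)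
    (hcd : ∀ p ∈ coverPairs v, p ≠ (lo i, hi i) → c p = d (adjSwap i p.1, adjSwap i p.2)) :
    ∑ p ∈ coverPairs v, c p • schubert (v * Equiv.swap p.1 p.2) =
      dividedDifference i (∑ p ∈ coverPairs (v * adjSwap i),
        d p • schubert (v * adjSwap i * Equiv.swap p.1 p.2)) +
      c (lo i, hi i) • schubert (v * adjSwap i) := by
  rw [← Finset.sum_erase_add _ _ (lo_hi_mem_coverPairs h)]
  congr 1
  rw [dividedDifference_sum]
  simp only [dividedDifference_zsmul, dividedDifference_schubert, smul_ite, smul_zero]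
  rw [← Finset.sum_filter]
  have hl := length_mul_adjSwap v i h
  have conj : ∀ a b, v * adjSwap i * Equiv.swap (adjSwap i a) (adjSwap i b) =
      v * Equiv.swap a b * adjSwap i := mul_swap_conj v i
  refine Finset.sum_nbij' (fun p => (adjSwap i p.1, adjSwap i p.2))
    (fun p => (adjSwap i p.1, adjSwap i p.2)) ?_ ?_ ?_ ?_ ?_
  · intro p hp
    rw [Finset.mem_erase] at hp
    have hasc := coverPairs_ascent h hp.2 hp.1
    have h2 := length_mul_adjSwap _ i hasc
    have h1 := mem_coverPairs.1 hp.2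
    simp only [Finset.mem_filter, mem_coverPairs, conj]
    refine ⟨⟨adjSwap_lt_adjSwap i h1.1 fun e => hp.1 (Prod.ext e.1 e.2), by omega⟩, ?_⟩
    rw [Equiv.Perm.mul_apply, Equiv.Perm.mul_apply _ (adjSwap i), adjSwap_lo, adjSwap_hi]
    exact hasc
  · rintro ⟨a, b⟩ hp
    simp only [Finset.mem_filter, mem_coverPairs] at hp
    obtain ⟨⟨h1, h2⟩, h3⟩ := hp
    have hab : ¬ (a = lo i ∧ b = hi i) := by
      rintro ⟨rfl, rfl⟩
      rw [show Equiv.swap (lo i) (hi i) = adjSwap i from rfl, mul_adjSwap_mul_adjSwap] at h2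
      omega
    have e := conj (adjSwap i a) (adjSwap i b)
    rw [adjSwap_adjSwap, adjSwap_adjSwap] at e
    have e2 : v * adjSwap i * Equiv.swap a b * adjSwap i =
        v * Equiv.swap (adjSwap i a) (adjSwap i b) := by
      rw [e, mul_adjSwap_mul_adjSwap]
    have h4 := length_mul_adjSwap' _ i h3
    rw [e2] at h4
    simp only [Finset.mem_erase, mem_coverPairs, ne_eq, Prod.mk.injEq]
    refine ⟨?_, adjSwap_lt_adjSwap i h1 hab, by omega⟩
    rintro ⟨e3, e4⟩
    have e3' : a = hi i := by rw [← adjSwap_lo, ← e3, adjSwap_adjSwap]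
    have e4' : b = lo i := by rw [← adjSwap_hi, ← e4, adjSwap_adjSwap]
    rw [e3', e4'] at h1
    exact (lo_lt_hi i).asymm h1
  · rintro ⟨a, b⟩ -
    simp only [adjSwap_adjSwap]
  · rintro ⟨a, b⟩ -
    simp only [adjSwap_adjSwap]
  · intro p hp
    rw [Finset.mem_erase] at hp
    simp only [conj, mul_adjSwap_mul_adjSwap]
    rw [hcd p hp.2 hp.1]

/-! ### Monk's rule -/

theorem exists_ascent_between {n : ℕ} {v : Equiv.Perm (Fin n)} {a b : Fin n} (hab : a < b)
    (hv : v a < v b) : ∃ i : Fin (n - 1), v (lo i) < v (hi i) ∧ a ≤ lo i ∧ lo i < b := by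
  by_contra hc
  push Not at hc
  have key : ∀ d (hd : (a : ℕ) + d < n), (a : ℕ) + d ≤ b → v ⟨a + d, hd⟩ ≤ v a := by
    intro d
    induction d with
    | zero => intro _ _; exact le_rfl
    | succ d ih =>
      intro hd hdb
      refine le_trans ?_ (ih (by omega) (by omega))
      by_contra hlt
      have := hc ⟨a + d, by omega⟩ (not_le.1 hlt) (Fin.le_def.2 (Nat.le_add_right _ _))
      have h2 : (b : ℕ) ≤ a + d := Fin.le_def.1 this
      omega
  rw [Fin.lt_def] at hab
  have h1 := key (b - a) (by have := b.2; omega) (by omega)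
  refine absurd hv (not_lt.2 ?_)
  rwa [show (⟨a + (b - a), by omega⟩ : Fin n) = b from Fin.ext (by simp only; omega)] at h1

theorem swapVars_prod_X_pow {n : ℕ} (i : Fin (n - 1)) (α : Fin n → ℕ)
    (h : α (lo i) = α (hi i)) :
    swapVars i (∏ j, MvPolynomial.X j ^ α j) =
      (∏ j, MvPolynomial.X j ^ α j : MvPolynomial (Fin n) ℤ) := by
  have hs : ∀ j, α (adjSwap i j) = α j := by
    intro j
    by_cases h1 : j = lo i
    · rw [h1, adjSwap_lo, h]
    by_cases h2 : j = hi i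
    · rw [h2, adjSwap_hi, h]
    rw [adjSwap_of_ne i h1 h2]
  unfold swapVars
  rw [map_prod]
  simp only [map_pow, MvPolynomial.rename_X]
  rw [← Equiv.prod_comp (adjSwap i) fun j => (MvPolynomial.X j ^ α j : MvPolynomial (Fin n) ℤ)]
  simp only [hs]

/-- `N_i` divides a monomial by `x_i` if its exponents at `i` and `i + 1` differ by one. -/
theorem prod_X_pow_update {n : ℕ} (i : Fin (n - 1)) {β : Fin n → ℕ}
    (h : β (lo i) = β (hi i) + 1) :
    (∏ j, MvPolynomial.X j ^ β j : MvPolynomial (Fin n) ℤ) =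
        MvPolynomial.X (lo i) * ∏ j, MvPolynomial.X j ^ Function.update β (lo i) (β (hi i)) j ∧
      dividedDifference i (∏ j, MvPolynomial.X j ^ β j : MvPolynomial (Fin n) ℤ) =
        ∏ j, MvPolynomial.X j ^ Function.update β (lo i) (β (hi i)) j := by
  have hlh := lo_lt_hi i
  set α := Function.update β (lo i) (β (hi i)) with hα
  have hαlo : α (lo i) = β (hi i) := Function.update_self _ _ _
  have hαne : ∀ j, j ≠ lo i → α j = β j := fun j hj => Function.update_of_ne hj _ _
  have hX : (∏ j, MvPolynomial.X j ^ β j : MvPolynomial (Fin n) ℤ) =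
      MvPolynomial.X (lo i) * ∏ j, MvPolynomial.X j ^ α j := by
    rw [← Finset.mul_prod_erase _ _ (Finset.mem_univ (lo i)),
      ← Finset.mul_prod_erase _ (fun j => (MvPolynomial.X j ^ α j : MvPolynomial (Fin n) ℤ))
        (Finset.mem_univ (lo i)), ← mul_assoc, ← pow_succ', hαlo, h]
    congr 1
    exact Finset.prod_congr rfl fun j hj => by rw [hαne j (Finset.ne_of_mem_erase hj)]
  refine ⟨hX, ?_⟩
  rw [hX, dividedDifference_mul, dividedDifference_X,
    dividedDifference_of_symm i (swapVars_prod_X_pow i α (hαlo.trans (hαne _ hlh.ne').symm))]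
  simp [monkCoeff, hlh.ne']

/-- A permutation with a single ascent, at `r`, and with `v_r > v_k` for `k > r + 1`, avoids the
pattern `132`; its Schubert polynomial is a monomial, and so is that of `v s_r`. -/
theorem schubert_of_single_ascent {n : ℕ} (m : ℕ) (v : Equiv.Perm (Fin n)) (r : Fin (n - 1))
    (hm : (r : ℕ) = m)
    (hasc : v (lo r) < v (hi r)) (huniq : ∀ i, v (lo i) < v (hi i) → i = r)
    (hmax : ∀ k, hi r < k → v k < v (lo r)) :
    ∃ α : Fin n → ℕ, schubert v = ∏ j, MvPolynomial.X j ^ α j ∧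
      schubert (v * adjSwap r) = MvPolynomial.X (lo r) * schubert v ∧
      ∀ j, lo r < j → α j = n - 1 - j := by
  induction m using Nat.strong_induction_on generalizing v r with
  | _ m ih =>
  set w := v * adjSwap r with hw
  have wlo : w (lo r) = v (hi r) := by rw [hw, Equiv.Perm.mul_apply, adjSwap_lo]
  have whi : w (hi r) = v (lo r) := by rw [hw, Equiv.Perm.mul_apply, adjSwap_hi]
  have wne : ∀ k, k ≠ lo r → k ≠ hi r → w k = v k := fun k h1 h2 => by
    rw [hw, Equiv.Perm.mul_apply, adjSwap_of_ne r h1 h2]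
  have hlh := lo_lt_hi r
  have hwasc : ∀ i, w (lo i) < w (hi i) → (i : ℕ) + 1 = r := by
    intro i h
    by_contra hne
    have hir : i ≠ r := by
      rintro rfl
      rw [wlo, whi] at h
      exact h.asymm hasc
    have hir' : (i : ℕ) ≠ r := fun e => hir (Fin.ext e)
    have e1 : hi i ≠ lo r := fun e => hne (congrArg Fin.val e)
    have e2 : hi i ≠ hi r := fun e => hir' (by simpa using congrArg Fin.val e)
    have e3 : lo i ≠ lo r := fun e => hir' (congrArg (Fin.val (n := n)) e)
    rw [wne _ e1 e2] at h
    by_cases e4 : lo i = hi r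
    · rw [e4, whi] at h
      refine h.asymm (hmax _ ?_)
      rw [← e4]
      exact lo_lt_hi i
    · rw [wne _ e3 e4] at h
      exact hir (huniq i h)
  obtain ⟨β, hβ, hβ'⟩ : ∃ β : Fin n → ℕ, schubert w = ∏ j, MvPolynomial.X j ^ β j ∧
      ∀ j, lo r ≤ j → β j = n - 1 - j := by
    by_cases hl : w = longest n
    · exact ⟨_, by rw [hl, schubert_longest], fun _ _ => rfl⟩
    obtain ⟨i, hi'⟩ := exists_ascent hl
    have hir := hwasc i hi'
    have hhi : hi i = lo r := Fin.ext hir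
    have e3 : lo i ≠ lo r := fun e => by have := congrArg Fin.val e; simp only at this; omega
    have e4 : lo i ≠ hi r := fun e => by have := congrArg Fin.val e; simp only at this; omega
    have hvi : v (lo r) < v (lo i) := by
      by_contra hc
      have h1 : v (lo i) < v (hi i) := by
        rw [hhi]
        exact lt_of_le_of_ne (not_lt.1 hc) (v.injective.ne e3)
      have := congrArg Fin.val (huniq i h1)
      omega
    obtain ⟨α, hα, -, hα'⟩ := ih i (by omega) w i rfl hi'
      (fun i' h' => Fin.ext (by have := hwasc i' h'; omega)) (by
        intro k hk
        rw [hhi] at hk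
        rw [wne _ e3 e4]
        by_cases hk' : k = hi r
        · rw [hk', whi]
          exact hvi
        · rw [wne _ hk.ne' hk']
          exact (hmax k (hi_lt_of_lo_lt hk hk')).trans hvi)
    refine ⟨α, hα, fun j hj => hα' j (lt_of_lt_of_le ?_ hj)⟩
    rw [← hhi]
    exact lo_lt_hi i
  have hr := r.2
  obtain ⟨hX, hN⟩ := prod_X_pow_update r (β := β)
    (by rw [hβ' _ le_rfl, hβ' _ hlh.le, val_lo, val_hi]; omega)
  rw [← hβ] at hX
  rw [← hβ, hw, ← schubert_eq_dividedDifference v r hasc] at hN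
  exact ⟨_, hN, by rw [hX, hN], fun j hj => by rw [Function.update_of_ne hj.ne', hβ' j hj.le]⟩

/-- Monk's rule for `x_r 𝔖_v`, in the case where some later entry exceeds `v_r`; this condition
ensures that no term indexed by a permutation outside `S_n` occurs. The rule is propagated from
`v s_i` to `v` along an ascent `i` that respects the condition. If there is none, then `v` has
`r` as its only ascent and the Schubert polynomials involved are monomials. -/
theorem monk {n : ℕ} (v : Equiv.Perm (Fin n)) :
    ∀ r : Fin n, (∃ k, r < k ∧ v r < v k) → MvPolynomial.X r * schubert v =
      ∑ p ∈ coverPairs v, monkCoeff r p • schubert (v * Equiv.swap p.1 p.2) := by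
  induction v using length_desc_induction with
  | h v ih =>
  intro r hr
  by_cases hA : ∃ i : Fin (n - 1), v (lo i) < v (hi i) ∧
      ∃ k, adjSwap i r < k ∧ v r < v (adjSwap i k)
  · obtain ⟨i, hi', k, hk, hvk⟩ := hA
    have h1 := ih (v * adjSwap i) (by rw [length_mul_adjSwap v i hi']; omega) (adjSwap i r)
      ⟨k, hk, by rwa [Equiv.Perm.mul_apply, Equiv.Perm.mul_apply, adjSwap_adjSwap]⟩
    have heq : ∀ a, (a = adjSwap i r) = (adjSwap i a = r) := fun a =>
      propext ⟨fun e => by rw [e, adjSwap_adjSwap], fun e => by rw [← e, adjSwap_adjSwap]⟩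
    rw [sum_coverPairs_of_ascent hi' (monkCoeff r) (monkCoeff (adjSwap i r))
      (fun p _ _ => by simp only [monkCoeff, heq, adjSwap_adjSwap]), ← h1, dividedDifference_mul,
      dividedDifference_X, swapVars_X, adjSwap_adjSwap, ← schubert_eq_dividedDifference v i hi']
    have hc : monkCoeff (adjSwap i r) (lo i, hi i) = - monkCoeff r (lo i, hi i) := by
      simp only [monkCoeff, heq, adjSwap_lo, adjSwap_hi]
      ring
    rw [hc, zsmul_eq_mul, MvPolynomial.C_neg]
    simp
  · push Not at hA
    obtain ⟨k₀, hk₀, hvk₀⟩ := hr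
    obtain ⟨i, hi', hri, hik⟩ := exists_ascent_between hk₀ hvk₀
    have huniq : ∀ j : Fin (n - 1), v (lo j) < v (hi j) → lo j = r := by
      intro j hj
      by_contra hne
      have h1 := hA j hj (adjSwap j k₀)
        (adjSwap_lt_adjSwap j hk₀ fun e => hne e.1.symm)
      rw [adjSwap_adjSwap] at h1
      exact absurd hvk₀ (not_lt.2 h1)
    have hir := huniq i hi'
    subst hir
    have hmax : ∀ k, hi i < k → v k < v (lo i) := by
      intro k hk
      have hne := ((lo_lt_hi i).trans hk).ne'
      have h1 := hA i hi' k (by rwa [adjSwap_lo])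
      rw [adjSwap_of_ne i hne hk.ne'] at h1
      exact lt_of_le_of_ne h1 (v.injective.ne hne)
    obtain ⟨-, -, hS, -⟩ := schubert_of_single_ascent i v i rfl hi'
      (fun j hj => Fin.ext (congrArg (Fin.val (n := n)) (huniq j hj))) hmax
    rw [← hS, Finset.sum_eq_single (lo i, hi i)]
    · simp [monkCoeff, (lo_lt_hi i).ne', adjSwap]
    · rintro ⟨a, b⟩ hp hne
      have h1 := coverPairs_lt hp
      have h2 := (mem_coverPairs.1 hp).1
      simp only at h1 h2
      have ha : a ≠ lo i := by
        rintro rfl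
        exact h1.asymm (hmax b (hi_lt_of_lo_lt h2 fun e => hne (by rw [e])))
      have hb : b ≠ lo i := by
        rintro rfl
        obtain ⟨j, hj, -, hjb⟩ := exists_ascent_between h2 h1
        exact hjb.ne (huniq j hj)
      simp [monkCoeff, ha, hb]
    · intro h
      exact absurd (lo_hi_mem_coverPairs hi') h

/-! ### The derivations `∑ x_j ^ k ∂/∂x_j` -/

/-- The derivation `∑_j x_j ^ k ∂/∂x_j` of the polynomial ring. -/
noncomputable def powDeriv (n k : ℕ) :
    Derivation ℤ (MvPolynomial (Fin n) ℤ) (MvPolynomial (Fin n) ℤ) :=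
  MvPolynomial.mkDerivation ℤ fun j => MvPolynomial.X j ^ k

theorem powDeriv_X {n : ℕ} (k : ℕ) (j : Fin n) :
    powDeriv n k (MvPolynomial.X j) = MvPolynomial.X j ^ k :=
  MvPolynomial.mkDerivation_X _ _ _

theorem powDeriv_mul {n : ℕ} (k : ℕ) (f g : MvPolynomial (Fin n) ℤ) :
    powDeriv n k (f * g) = f * powDeriv n k g + g * powDeriv n k f := by
  rw [Derivation.leibniz, smul_eq_mul, smul_eq_mul]

theorem powDeriv_swapVars {n : ℕ} (k : ℕ) (i : Fin (n - 1)) (g : MvPolynomial (Fin n) ℤ) :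
    powDeriv n k (swapVars i g) = swapVars i (powDeriv n k g) := by
  unfold swapVars
  induction g using MvPolynomial.induction_on with
  | C a => simp [powDeriv]
  | add p q hp hq => simp only [map_add, hp, hq]
  | mul_X p j hp =>
    simp only [powDeriv_mul, map_mul, map_add, hp, MvPolynomial.rename_X, powDeriv_X, map_pow]

theorem eval_one_powDeriv {n : ℕ} (k : ℕ) (g : MvPolynomial (Fin n) ℤ) :
    MvPolynomial.eval (fun _ => (1 : ℤ)) (powDeriv n k g) =
      MvPolynomial.eval (fun _ => (1 : ℤ)) (powDeriv n 0 g) := by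
  induction g using MvPolynomial.induction_on with
  | C a => simp [powDeriv]
  | add p q hp hq => simp only [map_add, hp, hq]
  | mul_X p j hp =>
    simp only [powDeriv_mul, map_mul, map_add, hp, powDeriv_X, map_pow, MvPolynomial.eval_X,
      one_pow]

theorem powDeriv_prod_X_pow {n : ℕ} (k : ℕ) (α : Fin n → ℕ) (s : Finset (Fin n)) :
    powDeriv n k (∏ j ∈ s, MvPolynomial.X j ^ α j) =
      ∑ j ∈ s, (α j : MvPolynomial (Fin n) ℤ) *
        (MvPolynomial.X j ^ (α j - 1 + k) * ∏ l ∈ s.erase j, MvPolynomial.X l ^ α l) := by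
  classical
  induction s using Finset.induction_on with
  | empty => simp
  | insert a s ha ih =>
    rw [Finset.prod_insert ha, powDeriv_mul, ih, Finset.sum_insert ha, Finset.erase_insert ha,
      Derivation.leibniz_pow, powDeriv_X, Finset.mul_sum, add_comm]
    congr 1
    · simp only [nsmul_eq_mul, smul_eq_mul, pow_add]
      ring
    · refine Finset.sum_congr rfl fun j hj => ?_
      have hja : a ≠ j := fun e => ha (e ▸ hj)
      rw [Finset.erase_insert_of_ne hja, Finset.prod_insert fun h => ha (Finset.mem_of_mem_erase h)]
      ring

theorem powDeriv_succ_prod_X_pow {n : ℕ} (k : ℕ) (α : Fin n → ℕ) :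
    powDeriv n (k + 1) (∏ j, MvPolynomial.X j ^ α j) =
      (∑ j, (α j : MvPolynomial (Fin n) ℤ) * MvPolynomial.X j ^ k) *
        ∏ j, MvPolynomial.X j ^ α j := by
  rw [powDeriv_prod_X_pow, Finset.sum_mul]
  refine Finset.sum_congr rfl fun j _ => ?_
  rw [← Finset.mul_prod_erase _ _ (Finset.mem_univ j), mul_assoc]
  rcases Nat.eq_zero_or_pos (α j) with h | h
  · simp [h]
  · rw [← mul_assoc (MvPolynomial.X j ^ k), ← pow_add]
    congr 3
    omega

/-- The commutator of `∑ x_j ^ k ∂/∂x_j` and `N_i` is the negative of the multiplication by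
`(x_i ^ k - x_{i+1} ^ k) / (x_i - x_{i+1})` after `N_i`. -/
theorem sub_mul_powDeriv_dividedDifference {n : ℕ} (k : ℕ) (i : Fin (n - 1))
    (g : MvPolynomial (Fin n) ℤ) :
    (MvPolynomial.X (lo i) - MvPolynomial.X (hi i)) * powDeriv n k (dividedDifference i g) =
      (MvPolynomial.X (lo i) - MvPolynomial.X (hi i)) * dividedDifference i (powDeriv n k g) -
      (MvPolynomial.X (lo i) ^ k - MvPolynomial.X (hi i) ^ k) * dividedDifference i g := by
  have h1 := congrArg (powDeriv n k) (dividedDifference_spec i g)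
  have h2 := dividedDifference_spec i (powDeriv n k g)
  rw [powDeriv_mul, map_sub, map_sub, powDeriv_X, powDeriv_X, powDeriv_swapVars] at h1
  linear_combination h2 - h1

theorem X_lo_sub_X_hi_ne_zero {n : ℕ} (i : Fin (n - 1)) :
    (MvPolynomial.X (lo i) - MvPolynomial.X (hi i) : MvPolynomial (Fin n) ℤ) ≠ 0 :=
  X_sub_X_ne_zero (by simp)

theorem powDeriv_zero_dividedDifference {n : ℕ} (i : Fin (n - 1)) (g : MvPolynomial (Fin n) ℤ) :
    powDeriv n 0 (dividedDifference i g) = dividedDifference i (powDeriv n 0 g) :=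
  mul_left_cancel₀ (X_lo_sub_X_hi_ne_zero i)
    (by linear_combination sub_mul_powDeriv_dividedDifference 0 i g)

theorem powDeriv_one_dividedDifference {n : ℕ} (i : Fin (n - 1)) (g : MvPolynomial (Fin n) ℤ) :
    powDeriv n 1 (dividedDifference i g) =
      dividedDifference i (powDeriv n 1 g) - dividedDifference i g :=
  mul_left_cancel₀ (X_lo_sub_X_hi_ne_zero i)
    (by linear_combination sub_mul_powDeriv_dividedDifference 1 i g)

theorem powDeriv_two_dividedDifference {n : ℕ} (i : Fin (n - 1)) (g : MvPolynomial (Fin n) ℤ) :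
    powDeriv n 2 (dividedDifference i g) = dividedDifference i (powDeriv n 2 g) -
      (MvPolynomial.X (lo i) + MvPolynomial.X (hi i)) * dividedDifference i g :=
  mul_left_cancel₀ (X_lo_sub_X_hi_ne_zero i)
    (by linear_combination sub_mul_powDeriv_dividedDifference 2 i g)

/-! ### Degrees of Schubert polynomials -/

theorem sum_staircase (n : ℕ) : ∑ j : Fin n, (n - 1 - (j : ℕ)) = n.choose 2 := by
  rw [Fin.sum_univ_eq_sum_range fun j => n - 1 - j, Finset.sum_range_reflect fun j => j,
    Finset.sum_range_id, Nat.choose_two_right]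

theorem length_longest (n : ℕ) : length (longest n) = n.choose 2 := by
  rw [length_eq_invCount, ← sum_staircase, invCount, Finset.card_filter,
    ← Finset.univ_product_univ, Finset.sum_product]
  refine Finset.sum_congr rfl fun j _ => ?_
  have : ∀ k : Fin n, (j < k ∧ longest n k < longest n j) = (k ∈ Finset.Ioi j) := by
    intro k
    simp [longest]
  simp only [this]
  rw [← Finset.card_filter, Finset.filter_univ_mem, Fin.card_Ioi]

theorem powDeriv_one_schubert {n : ℕ} (v : Equiv.Perm (Fin n)) :
    powDeriv n 1 (schubert v) = (length v : ℤ) • schubert v := by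
  induction v using ascent_induction with
  | h0 =>
    rw [schubert_longest, powDeriv_succ_prod_X_pow, length_longest, ← sum_staircase]
    simp
  | step v i h ih =>
    rw [schubert_eq_dividedDifference v i h, powDeriv_one_dividedDifference, ih,
      dividedDifference_zsmul, length_mul_adjSwap v i h]
    push_cast
    rw [add_smul, one_smul, add_sub_cancel_right]

/-- The number of monomials of `𝔖_w`, counted with coefficients: `𝔖_w(1, …, 1)`. -/
noncomputable def schubertOne {n : ℕ} (w : Equiv.Perm (Fin n)) : ℤ :=
  MvPolynomial.eval (fun _ => (1 : ℤ)) (schubert w)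

theorem eval_one_powDeriv_schubert {n : ℕ} (k : ℕ) (v : Equiv.Perm (Fin n)) :
    MvPolynomial.eval (fun _ => (1 : ℤ)) (powDeriv n k (schubert v)) =
      length v * schubertOne v := by
  rw [eval_one_powDeriv, ← eval_one_powDeriv 1, powDeriv_one_schubert]
  simp [schubertOne]

theorem schubertOne_longest (n : ℕ) : schubertOne (longest n) = 1 := by
  simp [schubertOne, schubert_longest]

/-! ### The strong order: the expansion with the weights `1 + 2 b` -/

/-- `b` for the cover `v ⋖ v t_{ab}`: the number of larger entries between `a` and `b`. -/
def bPair {n : ℕ} (v : Equiv.Perm (Fin n)) (p : Fin n × Fin n) : ℕ :=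
  (Finset.univ.filter fun k => p.1 < k ∧ k < p.2 ∧ v p.2 < v k).card

/-- The staircase linear form `∑ (n - j) x_j`, with `j` counted from `1`. -/
noncomputable def staircaseForm (n : ℕ) : MvPolynomial (Fin n) ℤ :=
  ∑ j : Fin n, ((n - 1 - (j : ℕ) : ℕ) : MvPolynomial (Fin n) ℤ) * MvPolynomial.X j

theorem swapVars_staircaseForm {n : ℕ} (i : Fin (n - 1)) :
    swapVars i (staircaseForm n) =
      staircaseForm n - (MvPolynomial.X (lo i) - MvPolynomial.X (hi i)) := by
  rw [eq_sub_iff_add_eq, ← eq_sub_iff_add_eq', staircaseForm]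
  have hs : swapVars i (∑ j : Fin n, ((n - 1 - (j : ℕ) : ℕ) : MvPolynomial (Fin n) ℤ) *
      MvPolynomial.X j) = ∑ j : Fin n, ((n - 1 - (adjSwap i j : ℕ) : ℕ) :
        MvPolynomial (Fin n) ℤ) * MvPolynomial.X j := by
    rw [← Equiv.sum_comp (adjSwap i)]
    unfold swapVars
    simp [adjSwap_adjSwap]
  rw [hs, ← Finset.sum_sub_distrib, Fintype.sum_eq_add (lo i) (hi i) (lo_lt_hi i).ne]
  · rw [adjSwap_lo, adjSwap_hi, val_lo, val_hi]
    have hin := i.2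
    rw [show n - 1 - (i : ℕ) = n - 1 - (i + 1) + 1 by omega]
    push_cast
    ring
  · rintro j ⟨h1, h2⟩
    rw [adjSwap_of_ne i h1 h2, sub_self]

theorem dividedDifference_staircaseForm {n : ℕ} (i : Fin (n - 1)) :
    dividedDifference i (staircaseForm n) = 1 :=
  dividedDifference_eq i (by rw [swapVars_staircaseForm]; ring)

/-- The effect of `s_i` on the number `b` of a cover: it changes only if the transposition moves
the entry at `i` of `v` (which becomes the entry at `i + 1` of `v s_i`), and then by one. -/
theorem bPair_mul_adjSwap {n : ℕ} {v : Equiv.Perm (Fin n)} {i : Fin (n - 1)}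
    (h : v (lo i) < v (hi i)) {p : Fin n × Fin n} (hp : p ∈ coverPairs v)
    (hne : p ≠ (lo i, hi i)) :
    (bPair v p : ℤ) =
      bPair (v * adjSwap i) (adjSwap i p.1, adjSwap i p.2) + monkCoeff (lo i) p := by
  have hab := (mem_coverPairs.1 hp).1
  have hv := coverPairs_lt hp
  have hbet := fun k => coverPairs_not_between hp (k := k)
  obtain ⟨a, b⟩ := p
  simp only at hab hv hbet
  have hlh := lo_lt_hi i
  have hcard : bPair (v * adjSwap i) (adjSwap i a, adjSwap i b) = (Finset.univ.filter fun k =>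
      adjSwap i a < adjSwap i k ∧ adjSwap i k < adjSwap i b ∧ v b < v k).card := by
    refine Finset.card_nbij' (adjSwap i) (adjSwap i) ?_ ?_ ?_ ?_ <;> intro k <;>
      simp [adjSwap_adjSwap]
  rw [hcard, bPair, Finset.card_filter, Finset.card_filter, ← sub_eq_iff_eq_add']
  push_cast
  -- The two counts, re-indexed by `s_i`, agree at every position except possibly `i + 1`.
  rw [← Finset.sum_sub_distrib, Finset.sum_eq_single (hi i)]
  · rw [adjSwap_hi]
    unfold monkCoeff
    by_cases ha : a = lo i
    · subst ha
      have hb : hi i < b := hi_lt_of_lo_lt hab fun e => hne (by rw [e])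
      simp [adjSwap_lo, hlh, hlh.asymm, hb, hab.ne', hbet _ hlh hb h]
    by_cases hb : b = lo i
    · subst hb
      simp [adjSwap_lo, hlh, hlh.asymm, h, ha, adjSwap_of_ne i ha (hab.trans hlh).ne, hab]
    by_cases ha' : a = hi i
    · subst ha'
      simp [adjSwap_hi, ha, hb]
    by_cases hb' : b = hi i
    · subst hb'
      simp [adjSwap_hi, ha, hb]
    have e1 : a < hi i ↔ a < lo i := ⟨fun h => lt_lo_of_lt_hi h ha, fun h => h.trans hlh⟩
    have e2 : hi i < b ↔ lo i < b := ⟨hlh.trans, fun h => hi_lt_of_lo_lt h hb'⟩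
    simp [adjSwap_of_ne i ha ha', adjSwap_of_ne i hb hb', ha, hb, e1, e2]
  · intro k _ hk
    rw [sub_eq_zero]
    refine if_congr ?_ rfl rfl
    by_cases hkl : k = lo i
    · subst hkl
      by_cases hvk : v b < v (lo i)
      · have ha : a ≠ lo i := by rintro rfl; exact hv.asymm hvk
        have hb : b ≠ lo i := by rintro rfl; exact hvk.false
        have ha' : a ≠ hi i := by rintro rfl; exact (hv.trans hvk).asymm h
        have hb' : b ≠ hi i := by rintro rfl; exact hvk.asymm h
        have e1 : a < hi i ↔ a < lo i := ⟨fun h => lt_lo_of_lt_hi h ha, fun h => h.trans hlh⟩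
        have e2 : hi i < b ↔ lo i < b := ⟨hlh.trans, fun h => hi_lt_of_lo_lt h hb'⟩
        rw [adjSwap_lo, adjSwap_of_ne i ha ha', adjSwap_of_ne i hb hb', e1, e2]
      · simp [hvk]
    · have e : ∀ x : Fin n, (adjSwap i x < k ↔ x < k) ∧ (k < adjSwap i x ↔ k < x) := by
        intro x
        have hk1 : lo i < k ↔ hi i < k := ⟨fun h => hi_lt_of_lo_lt h hk, hlh.trans⟩
        have hk2 : k < hi i ↔ k < lo i := ⟨fun h => lt_lo_of_lt_hi h hkl, fun h => h.trans hlh⟩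
        by_cases hx : x = lo i
        · rw [hx, adjSwap_lo, hk1, hk2]
          exact ⟨Iff.rfl, Iff.rfl⟩
        by_cases hx' : x = hi i
        · rw [hx', adjSwap_hi, hk1, hk2]
          exact ⟨Iff.rfl, Iff.rfl⟩
        rw [adjSwap_of_ne i hx hx']
        exact ⟨Iff.rfl, Iff.rfl⟩
      rw [adjSwap_of_ne i hkl hk, (e a).1, (e b).2]
  · exact fun h => absurd (Finset.mem_univ _) h

/-- The operator `∑ ρ_j x_j - ∑ x_j² ∂/∂x_j` expands `𝔖_v` along the covers of `v` in the strong
order. Passing from `v s_i` to `v` produces the error term `2 x_i 𝔖_v`, which Monk's rule turns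
into the change of the numbers `b`. -/
theorem strong_order_expansion {n : ℕ} (v : Equiv.Perm (Fin n)) :
    staircaseForm n * schubert v - powDeriv n 2 (schubert v) =
      ∑ p ∈ coverPairs v, (1 + 2 * bPair v p : ℤ) • schubert (v * Equiv.swap p.1 p.2) := by
  induction v using ascent_induction with
  | h0 =>
    have h : coverPairs (longest n) = ∅ := by
      refine Finset.eq_empty_of_forall_notMem fun p hp => ?_
      have h1 := coverPairs_lt hp
      simp only [longest, Fin.revPerm_apply, Fin.rev_lt_rev] at h1
      exact h1.asymm (mem_coverPairs.1 hp).1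
    rw [h, schubert_longest, powDeriv_succ_prod_X_pow, staircaseForm]
    simp
  | step v i h ih =>
    have hm := monk v (lo i) ⟨hi i, lo_lt_hi i, h⟩
    have hb : bPair v (lo i, hi i) = 0 := by
      rw [bPair, Finset.card_eq_zero, Finset.filter_eq_empty_iff]
      rintro k - ⟨h1, h2, -⟩
      exact absurd h1 (not_lt.2 (Nat.le_of_lt_succ h2))
    have hs := sum_coverPairs_of_ascent h
      (fun p => 1 + 2 * (bPair v p : ℤ) - 2 * monkCoeff (lo i) p)
      (fun p => 1 + 2 * (bPair (v * adjSwap i) p : ℤ))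
      (fun p hp hne => by rw [bPair_mul_adjSwap h hp hne]; ring)
    simp only [sub_smul, mul_smul 2 (monkCoeff _ _), Finset.sum_sub_distrib,
      ← Finset.smul_sum] at hs
    rw [← hm, ← ih, dividedDifference_sub, dividedDifference_mul,
      dividedDifference_staircaseForm, swapVars_staircaseForm, hb,
      ← schubert_eq_dividedDifference v i h] at hs
    have h2 := powDeriv_two_dividedDifference i (schubert (v * adjSwap i))
    rw [← schubert_eq_dividedDifference v i h] at h2
    have hc : monkCoeff (lo i) (lo i, hi i) = 1 := by
      simp [monkCoeff, (lo_lt_hi i).ne']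
    rw [hc] at hs
    simp only [zsmul_eq_mul] at hs ⊢
    push_cast at hs ⊢
    linear_combination -hs - h2

theorem sum_coverPairs_bPair {n : ℕ} (v : Equiv.Perm (Fin n)) :
    ∑ p ∈ coverPairs v, (1 + 2 * bPair v p : ℤ) * schubertOne (v * Equiv.swap p.1 p.2) =
      ((n.choose 2 : ℤ) - length v) * schubertOne v := by
  have h := congrArg (MvPolynomial.eval fun _ => (1 : ℤ)) (strong_order_expansion v)
  rw [map_sub, map_mul, eval_one_powDeriv_schubert, map_sum] at h
  have hs : MvPolynomial.eval (fun _ => (1 : ℤ)) (staircaseForm n) = n.choose 2 := by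
    rw [← sum_staircase]
    simp [staircaseForm]
  rw [hs] at h
  simp only [zsmul_eq_mul, map_mul, map_intCast] at h
  rw [sub_mul]
  exact h.symm

/-! ### Invariance of `𝔖_w(1, …, 1)` under inversion -/

theorem adjSwap_mul_longest {n : ℕ} (j k : Fin (n - 1)) (h : (j : ℕ) + k + 2 = n) :
    adjSwap k * longest n = longest n * adjSwap j := by
  have e1 : longest n (lo j) = hi k := Fin.ext (by simp [longest, Fin.val_rev]; omega)
  have e2 : longest n (hi j) = lo k := Fin.ext (by simp [longest, Fin.val_rev]; omega)
  have := Equiv.swap_apply_apply (longest n) (lo j) (hi j)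
  rw [e1, e2, Equiv.swap_comm] at this
  rw [adjSwap, adjSwap, this, inv_mul_cancel_right]

/-- The sum of the partial derivatives of `𝔖_w` expands along the covers of `w` in the left weak
order. The operator commutes with every `N_i`, so that the formula descends from `w₀`. -/
theorem powDeriv_zero_schubert {n : ℕ} (w : Equiv.Perm (Fin n)) :
    powDeriv n 0 (schubert w) = ∑ k : Fin (n - 1),
      if length (adjSwap k * w) + 1 = length w then
        ((k : ℤ) + 1) • schubert (adjSwap k * w) else 0 := by
  induction w using ascent_induction with
  | h0 =>
    rw [schubert_longest, powDeriv_prod_X_pow]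
    symm
    refine Finset.sum_of_injOn (fun k : Fin (n - 1) => (⟨n - 2 - k, by omega⟩ : Fin n)) ?_ ?_ ?_ ?_
    · intro a _ b _ hab
      have := congrArg (Fin.val (n := n)) hab
      simp only at this
      exact Fin.ext (by omega)
    · exact fun _ _ => Finset.mem_coe.2 (Finset.mem_univ _)
    · intro j _ hj
      have hj' : (j : ℕ) = n - 1 := by
        by_contra hc
        refine hj ⟨⟨n - 2 - j, by omega⟩, Finset.mem_coe.2 (Finset.mem_univ _), Fin.ext ?_⟩
        simp only
        omega
      simp [hj']
    · intro k _
      let j : Fin (n - 1) := ⟨n - 2 - k, by omega⟩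
      have hjk : (j : ℕ) + k + 2 = n := by simp only [j]; omega
      have hd : longest n (hi j) < longest n (lo j) := by
        simp only [longest, Fin.revPerm_apply, Fin.rev_lt_rev]
        exact lo_lt_hi j
      rw [adjSwap_mul_longest j k hjk, if_pos (length_mul_adjSwap' _ j hd)]
      have h1 := dividedDifference_schubert (longest n) j
      rw [if_pos hd, schubert_longest, (prod_X_pow_update j
        (β := fun l => n - 1 - (l : ℕ)) (by simp only; omega)).2] at h1
      rw [← h1]
      change _ = ((n - 1 - (lo j : ℕ) : ℕ) : MvPolynomial (Fin n) ℤ) *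
        (MvPolynomial.X (lo j) ^ (n - 1 - (lo j : ℕ) - 1 + 0) *
          ∏ l ∈ Finset.univ.erase (lo j), MvPolynomial.X l ^ (n - 1 - (l : ℕ)))
      rw [show n - 1 - (lo j : ℕ) = k + 1 by rw [val_lo]; omega,
        ← Finset.mul_prod_erase _ _ (Finset.mem_univ (lo j)), Function.update_self,
        show n - 1 - (hi j : ℕ) = k + 1 - 1 + 0 by rw [val_hi]; omega]
      rw [Finset.prod_congr rfl fun l hl => by
        rw [Function.update_of_ne (Finset.ne_of_mem_erase hl)]]
      simp
  | step v i h ih =>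
    rw [schubert_eq_dividedDifference v i h, powDeriv_zero_dividedDifference, ih,
      dividedDifference_sum]
    refine Finset.sum_congr rfl fun k _ => ?_
    have h0 : dividedDifference i (0 : MvPolynomial (Fin n) ℤ) = 0 :=
      map_zero (dividedDifferenceHom i)
    have e : adjSwap k * (v * adjSwap i) * adjSwap i = adjSwap k * v := by
      rw [← mul_assoc, mul_adjSwap_mul_adjSwap]
    have h1 := length_mul_adjSwap v i h
    have h2 := length_mul_adjSwap_cases (adjSwap k * (v * adjSwap i)) i
    have h3 := length_adjSwap_mul_cases (v * adjSwap i) k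
    have h4 := length_adjSwap_mul_cases v k
    have h5 := length_mul_adjSwap_lt_iff (adjSwap k * (v * adjSwap i)) i
    rw [e] at h2 h5
    by_cases hc : length (adjSwap k * v) + 1 = length v
    · rw [if_pos hc, if_pos (by omega), dividedDifference_zsmul, dividedDifference_schubert,
        if_pos (h5.1 (by omega)), e]
    · rw [if_neg hc]
      split_ifs with hc2
      · rw [dividedDifference_zsmul, dividedDifference_schubert,
          if_neg fun h' => hc (by have := h5.2 h'; omega), smul_zero]
      · exact h0

/-- Macdonald's recursion for `𝔖_w(1, …, 1)`, over the left descents. -/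
theorem schubertOne_left {n : ℕ} (w : Equiv.Perm (Fin n)) :
    length w * schubertOne w = ∑ k : Fin (n - 1),
      if length (adjSwap k * w) + 1 = length w then
        ((k : ℤ) + 1) * schubertOne (adjSwap k * w) else 0 := by
  rw [← eval_one_powDeriv_schubert 0 w, powDeriv_zero_schubert, map_sum]
  refine Finset.sum_congr rfl fun k _ => ?_
  split_ifs
  · simp [schubertOne]
  · exact map_zero _

theorem length_eq_zero_iff {n : ℕ} (w : Equiv.Perm (Fin n)) : length w = 0 ↔ w = 1 := by
  rw [length_eq_invCount]
  constructor
  · intro h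
    obtain ⟨a, ha, hw⟩ := exists_word 0 w h
    rw [List.length_eq_zero_iff.1 ha] at hw
    exact hw.symm
  · rintro rfl
    exact invCount_one n

/-- Macdonald's recursion over the right descents. It follows from the recursion over the left
descents: apply the latter on the left and, inductively, the former on the right, in either
order; both double sums range over the pairs with `ℓ(s_k w s_j) = ℓ(w) - 2`. -/
theorem schubertOne_right {n : ℕ} (w : Equiv.Perm (Fin n)) :
    length w * schubertOne w = ∑ j : Fin (n - 1),
      if length (w * adjSwap j) + 1 = length w then
        ((j : ℤ) + 1) * schubertOne (w * adjSwap j) else 0 := by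
  obtain ⟨l, hl⟩ : ∃ l, length w = l := ⟨_, rfl⟩
  induction l generalizing w with
  | zero =>
    rw [hl]
    simp
  | succ l ih =>
    rcases Nat.eq_zero_or_pos l with rfl | hpos
    · -- Here `w` is an adjacent transposition, and the two recursions agree term by term.
      rw [schubertOne_left]
      refine Finset.sum_congr rfl fun k _ => ?_
      have e1 : length (adjSwap k * w) + 1 = length w ↔ w = adjSwap k := by
        rw [hl, zero_add, Nat.succ_inj, length_eq_zero_iff, mul_eq_one_iff_inv_eq, adjSwap_inv]
        exact eq_comm
      have e2 : length (w * adjSwap k) + 1 = length w ↔ w = adjSwap k := by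
        rw [hl, zero_add, Nat.succ_inj, length_eq_zero_iff, mul_eq_one_iff_eq_inv, adjSwap_inv]
      simp only [e1, e2]
      split_ifs with h
      · rw [h]
      · rfl
    · have hne : (l : ℤ) ≠ 0 := by exact_mod_cast hpos.ne'
      refine mul_left_cancel₀ hne ?_
      -- Multiplied by `l`, both sides expand to the same double sum.
      have hlhs : (l : ℤ) * (length w * schubertOne w) = ∑ k : Fin (n - 1), ∑ j : Fin (n - 1),
          if length (adjSwap k * w * adjSwap j) + 1 = l then
            ((k : ℤ) + 1) * (((j : ℤ) + 1) * schubertOne (adjSwap k * w * adjSwap j)) else 0 := by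
        rw [schubertOne_left, Finset.mul_sum]
        refine Finset.sum_congr rfl fun k _ => ?_
        split_ifs with h
        · have h1 : length (adjSwap k * w) = l := by omega
          rw [mul_left_comm, ← h1, ih _ h1, Finset.mul_sum]
          refine Finset.sum_congr rfl fun j _ => ?_
          rw [mul_ite, mul_zero]
        · rw [mul_zero, Finset.sum_eq_zero]
          intro j _
          rw [if_neg]
          have h1 := length_adjSwap_mul_cases w k
          have h2 := length_mul_adjSwap_cases (adjSwap k * w) j
          omega
      rw [hlhs, Finset.sum_comm, Finset.mul_sum]
      refine Finset.sum_congr rfl fun j _ => ?_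
      split_ifs with h
      · have h1 : length (w * adjSwap j) = l := by omega
        rw [mul_left_comm, ← h1, schubertOne_left, h1, Finset.mul_sum]
        refine Finset.sum_congr rfl fun k _ => ?_
        rw [mul_ite, mul_zero, ← mul_assoc (adjSwap k), mul_left_comm]
      · rw [mul_zero, Finset.sum_eq_zero]
        intro k _
        rw [if_neg]
        have h1 := length_mul_adjSwap_cases w j
        have h2 := length_adjSwap_mul_cases (w * adjSwap j) k
        rw [← mul_assoc] at h2
        omega

theorem schubertOne_inv {n : ℕ} (w : Equiv.Perm (Fin n)) :
    schubertOne w⁻¹ = schubertOne w := by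
  obtain ⟨l, hl⟩ : ∃ l, length w = l := ⟨_, rfl⟩
  induction l generalizing w with
  | zero => rw [(length_eq_zero_iff w).1 hl, inv_one]
  | succ l ih =>
    have hne : (length w : ℤ) ≠ 0 := by rw [hl]; exact_mod_cast Nat.succ_ne_zero l
    refine mul_left_cancel₀ hne ?_
    have h1 := schubertOne_left w⁻¹
    rw [length_inv] at h1
    rw [h1, schubertOne_right]
    refine Finset.sum_congr rfl fun k _ => ?_
    have e : adjSwap k * w⁻¹ = (w * adjSwap k)⁻¹ := by rw [mul_inv_rev, adjSwap_inv]
    rw [e, length_inv]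
    split_ifs with h
    · rw [ih _ (by omega)]
    · rfl

/-! ### The strong order: general weights -/

/-- `c` for the cover `v ⋖ v t_{ab}`: the number of entries to the right of position `b` with a
value between `v_a` and `v_b`. -/
def cPair {n : ℕ} (v : Equiv.Perm (Fin n)) (p : Fin n × Fin n) : ℕ :=
  (Finset.univ.filter fun k => p.2 < k ∧ v p.1 < v k ∧ v k < v p.2).card

theorem map_mem_coverPairs_inv {n : ℕ} {v : Equiv.Perm (Fin n)} {p : Fin n × Fin n}
    (hp : p ∈ coverPairs v) : (v p.1, v p.2) ∈ coverPairs v⁻¹ := by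
  refine mem_coverPairs.2 ⟨coverPairs_lt hp, ?_⟩
  rw [Equiv.swap_apply_apply, ← mul_assoc, inv_mul_cancel_left, length_inv,
    ← (mem_coverPairs.1 hp).2, ← length_inv (v * _), mul_inv_rev, Equiv.swap_inv]

/-- Inversion of permutations exchanges the numbers `b` and `c` and preserves `𝔖_w(1, …, 1)`. -/
theorem sum_coverPairs_cPair {n : ℕ} (v : Equiv.Perm (Fin n)) :
    ∑ p ∈ coverPairs v, (1 + 2 * cPair v p : ℤ) * schubertOne (v * Equiv.swap p.1 p.2) =
      ((n.choose 2 : ℤ) - length v) * schubertOne v := by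
  rw [← length_inv v, ← schubertOne_inv v, ← sum_coverPairs_bPair v⁻¹]
  refine Finset.sum_nbij' (fun p => (v p.1, v p.2)) (fun p => (v⁻¹ p.1, v⁻¹ p.2))
    (fun p hp => map_mem_coverPairs_inv hp)
    (fun p hp => by simpa only [inv_inv] using map_mem_coverPairs_inv hp)
    (fun p _ => by simp) (fun p _ => by simp) ?_
  intro p hp
  have e : v⁻¹ * Equiv.swap (v p.1) (v p.2) = (v * Equiv.swap p.1 p.2)⁻¹ := by
    rw [Equiv.swap_apply_apply, ← mul_assoc, inv_mul_cancel_left, mul_inv_rev, Equiv.swap_inv]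
  have hc : cPair v p = bPair v⁻¹ (v p.1, v p.2) := by
    unfold cPair bPair
    refine Finset.card_nbij' v v.symm ?_ ?_ ?_ ?_ <;> intro k <;> simp <;> tauto
  simp only
  rw [e, schubertOne_inv, hc]

theorem swap_pair_unique {n : ℕ} {v : Equiv.Perm (Fin n)} {a b c d : Fin n} (hab : a < b)
    (hcd : c < d) (h : v * Equiv.swap a b = v * Equiv.swap c d) : a = c ∧ b = d := by
  have h1 := mul_left_cancel h
  have ha := DFunLike.congr_fun h1 a
  have hb := DFunLike.congr_fun h1 b
  rw [Equiv.swap_apply_left, Equiv.swap_apply_def] at ha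
  rw [Equiv.swap_apply_right, Equiv.swap_apply_def] at hb
  split_ifs at ha hb <;> first | exact ⟨‹_›, ‹_›⟩ | grind

theorem bNum_mul_swap {n : ℕ} (v : Equiv.Perm (Fin n)) {a b : Fin n} (hab : a < b) :
    bNum v (v * Equiv.swap a b) = bPair v (a, b) := by
  unfold bNum bPair
  congr 1
  ext k
  simp only [Finset.mem_filter, Finset.mem_univ, true_and]
  constructor
  · rintro ⟨i, j, hij, h, hk⟩
    obtain ⟨rfl, rfl⟩ := swap_pair_unique hab hij h
    exact hk
  · exact fun hk => ⟨a, b, hab, rfl, hk⟩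

theorem cNum_mul_swap {n : ℕ} (v : Equiv.Perm (Fin n)) {a b : Fin n} (hab : a < b) :
    cNum v (v * Equiv.swap a b) = cPair v (a, b) := by
  unfold cNum cPair
  congr 1
  ext k
  simp only [Finset.mem_filter, Finset.mem_univ, true_and]
  constructor
  · rintro ⟨i, j, hij, h, hk⟩
    obtain ⟨rfl, rfl⟩ := swap_pair_unique hab hij h
    exact hk
  · exact fun hk => ⟨a, b, hab, rfl, hk⟩

/-- Since `2 (1 + b (2 - z) + c z) = (2 - z) (1 + 2 b) + z (1 + 2 c)`, the expansions with the
weights `1 + 2 b` and `1 + 2 c` combine to an expansion with the weights for arbitrary `z`. -/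
theorem sum_coverPairs_macdonaldWeight {n : ℕ} (v : Equiv.Perm (Fin n)) :
    ∑ p ∈ coverPairs v, macdonaldWeight v (v * Equiv.swap p.1 p.2) *
        Polynomial.C (schubertOne (v * Equiv.swap p.1 p.2)) =
      Polynomial.C (((n.choose 2 : ℤ) - length v) * schubertOne v) := by
  have hb := congrArg Polynomial.C (sum_coverPairs_bPair v)
  have hc := congrArg Polynomial.C (sum_coverPairs_cPair v)
  rw [map_sum] at hb hc
  refine mul_left_cancel₀ (two_ne_zero (α := Polynomial ℤ)) ?_
  have key : 2 * Polynomial.C (((n.choose 2 : ℤ) - length v) * schubertOne v) =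
      (2 - Polynomial.X) * Polynomial.C (((n.choose 2 : ℤ) - length v) * schubertOne v) +
      Polynomial.X * Polynomial.C (((n.choose 2 : ℤ) - length v) * schubertOne v) := by ring
  rw [key]
  nth_rewrite 1 [← hb]
  rw [← hc, Finset.mul_sum, Finset.mul_sum, Finset.mul_sum, ← Finset.sum_add_distrib]
  refine Finset.sum_congr rfl fun p hp => ?_
  have hlt := (mem_coverPairs.1 hp).1
  rw [macdonaldWeight, bNum_mul_swap v hlt, cNum_mul_swap v hlt]
  simp only [map_mul, map_add, map_one, map_natCast, map_ofNat]
  ring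

/-! ### Recursion over the first step of a chain -/

theorem covers_iff {n : ℕ} (v u : Equiv.Perm (Fin n)) :
    Covers v u ↔ ∃ p ∈ coverPairs v, v * Equiv.swap p.1 p.2 = u := by
  constructor
  · rintro ⟨⟨i, j, hij, rfl⟩, h⟩
    exact ⟨(i, j), mem_coverPairs.2 ⟨hij, h⟩, rfl⟩
  · rintro ⟨p, hp, rfl⟩
    have h := mem_coverPairs.1 hp
    exact ⟨⟨p.1, p.2, h.1, rfl⟩, h.2⟩

theorem length_le_of_isChain {n : ℕ} {c : List (Equiv.Perm (Fin n))} {v w : Equiv.Perm (Fin n)}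
    (h : (v :: c).IsChain Covers) (hw : (v :: c).getLast? = some w) :
    length v + c.length = length w := by
  induction c generalizing v with
  | nil =>
    simp only [List.getLast?_singleton, Option.some.injEq] at hw
    simp [hw]
  | cons u c ih =>
    rw [List.isChain_cons_cons] at h
    rw [List.getLast?_cons_cons] at hw
    have h1 := ih h.2 hw
    have h2 := h.1.2
    rw [List.length_cons]
    omega

theorem weightedChainCount_self {n : ℕ} {R : Type*} [CommRing R]
    (wt : Equiv.Perm (Fin n) → Equiv.Perm (Fin n) → R) (w : Equiv.Perm (Fin n)) :
    weightedChainCount wt w w = 1 := by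
  have h : (saturatedChains_finite w w).toFinset = {[w]} := by
    ext c
    rw [Set.Finite.mem_toFinset, Finset.mem_singleton]
    constructor
    · rintro ⟨h1, h2, h3⟩
      obtain ⟨t, rfl⟩ := List.head?_eq_some_iff.1 h2
      have h4 := length_le_of_isChain h1 h3
      rw [List.length_eq_zero_iff.1 (show t.length = 0 by omega)]
    · rintro rfl
      exact ⟨List.isChain_singleton _, rfl, rfl⟩
  rw [weightedChainCount, h, Finset.sum_singleton]
  simp [chainWeight]

theorem weightedChainCount_of_ne {n : ℕ} {R : Type*} [CommRing R]
    (wt : Equiv.Perm (Fin n) → Equiv.Perm (Fin n) → R) {v w : Equiv.Perm (Fin n)} (hvw : v ≠ w) :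
    weightedChainCount wt v w = ∑ p ∈ coverPairs v,
      wt v (v * Equiv.swap p.1 p.2) * weightedChainCount wt (v * Equiv.swap p.1 p.2) w := by
  classical
  have h : (saturatedChains_finite v w).toFinset = (coverPairs v).biUnion fun p =>
      (saturatedChains_finite (v * Equiv.swap p.1 p.2) w).toFinset.image (List.cons v) := by
    ext c
    simp only [Set.Finite.mem_toFinset, Finset.mem_biUnion, Finset.mem_image]
    constructor
    · rintro ⟨h1, h2, h3⟩
      obtain ⟨t, rfl⟩ := List.head?_eq_some_iff.1 h2
      cases t with
      | nil =>
        simp only [List.getLast?_singleton, Option.some.injEq] at h3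
        exact absurd h3 hvw
      | cons u t =>
        rw [List.isChain_cons_cons] at h1
        rw [List.getLast?_cons_cons] at h3
        obtain ⟨p, hp, rfl⟩ := (covers_iff v u).1 h1.1
        exact ⟨p, hp, _, ⟨h1.2, rfl, h3⟩, rfl⟩
    · rintro ⟨p, hp, t, ⟨h1, h2, h3⟩, rfl⟩
      obtain ⟨t, rfl⟩ := List.head?_eq_some_iff.1 h2
      exact ⟨List.isChain_cons_cons.2 ⟨(covers_iff _ _).2 ⟨p, hp, rfl⟩, h1⟩, rfl,
        by rwa [List.getLast?_cons_cons]⟩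
  rw [weightedChainCount, h, Finset.sum_biUnion]
  · refine Finset.sum_congr rfl fun p _ => ?_
    rw [Finset.sum_image fun a _ b _ hab => (List.cons.inj hab).2, weightedChainCount,
      Finset.mul_sum]
    refine Finset.sum_congr rfl fun c hc => ?_
    rw [Set.Finite.mem_toFinset] at hc
    obtain ⟨t, rfl⟩ := List.head?_eq_some_iff.1 hc.2.1
    simp [chainWeight]
  · intro p hp q hq hpq
    rw [Function.onFun, Finset.disjoint_left]
    intro c hc hc'
    simp only [Finset.mem_image, Set.Finite.mem_toFinset] at hc hc'
    obtain ⟨s, hs, rfl⟩ := hc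
    obtain ⟨t, ht, hst⟩ := hc'
    rw [List.cons.injEq] at hst
    have e : some (v * Equiv.swap p.1 p.2) = some (v * Equiv.swap q.1 q.2) := by
      rw [← hs.2.1, ← ht.2.1, hst.2]
    obtain ⟨e1, e2⟩ := swap_pair_unique (mem_coverPairs.1 hp).1 (mem_coverPairs.1 hq).1
      (Option.some.inj e)
    exact hpq (Prod.ext e1 e2)

theorem length_le_choose_two {n : ℕ} (v : Equiv.Perm (Fin n)) : length v ≤ n.choose 2 := by
  induction v using ascent_induction with
  | h0 => exact (length_longest n).le
  | step v i h ih =>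
    rw [length_mul_adjSwap v i h] at ih
    omega

theorem weightedChainCount_longest {n : ℕ} (v : Equiv.Perm (Fin n)) :
    weightedChainCount macdonaldWeight v (longest n) =
      Polynomial.C (((n.choose 2 - length v).factorial : ℤ) * schubertOne v) := by
  induction v using length_desc_induction with
  | h v ih =>
  by_cases hv : v = longest n
  · rw [hv, weightedChainCount_self, length_longest, schubertOne_longest]
    simp
  · obtain ⟨i, hi'⟩ := exists_ascent hv
    obtain ⟨m, hm⟩ : ∃ m, n.choose 2 - length v = m + 1 := by
      have h1 := length_le_choose_two (v * adjSwap i)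
      rw [length_mul_adjSwap v i hi'] at h1
      exact ⟨n.choose 2 - length v - 1, by omega⟩
    have hm' : (n.choose 2 : ℤ) - length v = m + 1 := by omega
    have key := sum_coverPairs_macdonaldWeight v
    rw [weightedChainCount_of_ne _ hv, hm, Nat.factorial_succ]
    calc _ = ∑ p ∈ coverPairs v, Polynomial.C (m.factorial : ℤ) *
          (macdonaldWeight v (v * Equiv.swap p.1 p.2) *
            Polynomial.C (schubertOne (v * Equiv.swap p.1 p.2))) := by
          refine Finset.sum_congr rfl fun p hp => ?_
          have hl := (mem_coverPairs.1 hp).2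
          rw [ih _ (by omega), hl, show n.choose 2 - (length v + 1) = m by omega,
            Polynomial.C_mul]
          ring
      _ = _ := by
          rw [← Finset.mul_sum, key, hm', ← Polynomial.C_mul]
          congr 1
          push_cast
          ring

end BruhatChains

theorem theorem1p3 (n : ℕ) (w : Equiv.Perm (Fin n)) :
    BruhatChains.weightedChainCount BruhatChains.macdonaldWeight w (BruhatChains.longest n) =
        Polynomial.C (((n.choose 2 - BruhatChains.length w).factorial : ℤ) *
          MvPolynomial.eval (fun _ => (1 : ℤ)) (BruhatChains.schubert w)) ∧
      ∀ z₁ z₂ : ℤ,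
        Polynomial.eval z₁ (BruhatChains.weightedChainCount BruhatChains.macdonaldWeight w
            (BruhatChains.longest n)) =
          Polynomial.eval z₂ (BruhatChains.weightedChainCount BruhatChains.macdonaldWeight w
            (BruhatChains.longest n)) := by
  have h := BruhatChains.weightedChainCount_longest w
  exact ⟨h, fun z₁ z₂ => by rw [h, Polynomial.eval_C, Polynomial.eval_C]⟩
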